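/- Let $\mathbb M=(M_p)_{p\ge 0}$ be a weight sequence, i.e. a sequence of positive reals with $M_0=1$ and $M_p^2\le M_{p-1}M_{p+1}$ for $p\ge 1$, whose quotients $m_p:=M_{p+1}/M_p$ tend to $\infty$. Put $$\gamma(\mathbb M):=\sup\{\gamma>0:\ \exists a>0\ \forall q\ge p\ge 0,\ \tfrac{m_p}{(p+1)^{\gamma}}\le a\,\tfrac{m_q}{(q+1)^{\gamma}}\}\in[0,\infty]\qquad(\sup\emptyset:=0).$$ Suppose that $\gamma(\mathbb M)>0$ and that $\mathbb M$ satisfies (sm): there are $C_0>0$ and $H>1$ with $\log(m_{p+1}/m_p)\le C_0H^{p+1}$ for all $p\ge 0$. For $r>0$ let $S_r=\{z:\ |\arg z|<r\pi/2\}$, a sector of the Riemann surface of the logarithm. Let $\widetilde{\mathcal A}^u_{(\mathbb M)}(S_r)$ be the space of holomorphic $f:S_r\to\mathbb C$ such that for every $h>0$ there are a formal power series $\sum_{n\ge 0}a_nz^n$ with complex coefficients and a constant $C>0$ with $$\Big|f(z)-\sum_{n=0}^{p-1}a_nz^n\Big|\le C\,h^pM_p|z|^p\qquad\text{for all } z\in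 S_r,\ p\ge 0 .$$ This series is unique and does not depend on $h$, and it belongs to the space $\mathbb C[[z]]_{(\mathbb M)}$ of formal power series $\sum_{p\ge 0} a_pz^p$ with $\sup_{p\ge 0}|a_p|/(h^pM_p)<\infty$ for every $h>0$. The Borel map $\widetilde{\mathcal B}:\widetilde{\mathcal A}^u_{(\mathbb M)}(S_r)\to\mathbb C[[z]]_{(\mathbb M)}$ sends $f$ to this series. Let $\widetilde S^u_{(\mathbb M)}$ be the set of all $r>0$ for which $\widetilde{\mathcal B}:\widetilde{\mathcal A}^u_{(\mathbb M)}(S_r)\to\mathbb C[[z]]_{(\mathbb M)}$ is surjective. Then, for every real $r$ with $0<r<\gamma(\mathbb M)$, the Borel map $\widetilde{\mathcal B}:\widetilde{\mathcal A}^u_{(\mathbb M)}(S_r)\to\mathbb C[[z]]_{(\mathbb M)}$ is surjective; that is, $(0,\gamma(\mathbb M))\subset\widetilde S^u_{(\mathbb M)}$. -/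

import Mathlib

namespace Ultraholomorphic

noncomputable section

open Filter Topology

/-- The sequence of quotients `m_p = M_{p+1} / M_p`. -/
def quotients (M : ℕ → ℝ) (p : ℕ) : ℝ := M (p + 1) / M p

/-- Weight sequences: positive, normalized, log-convex, with quotients tending to infinity. -/
structure IsWeightSequence (M : ℕ → ℝ) : Prop where
  pos : ∀ p, 0 < M p
  zero : M 0 = 1
  logConvex : ∀ p, M (p + 1) ^ 2 ≤ M p * M (p + 2)
  tendsto : Tendsto (quotients M) atTop atTop

/-- The condition (sm): `M` has shifted moments. -/
def HasShiftedMoments (M : ℕ → ℝ) : Prop :=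
  ∃ C₀ : ℝ, 0 < C₀ ∧ ∃ H : ℝ, 1 < H ∧
    ∀ p : ℕ, Real.log (quotients M (p + 1) / quotients M p) ≤ C₀ * H ^ (p + 1)

def AlmostIncreasing (c : ℕ → ℝ) : Prop :=
  ∃ a : ℝ, 0 < a ∧ ∀ p q : ℕ, p ≤ q → c p ≤ a * c q

/-- The index `γ(M) ∈ [0, ∞]`: the supremum of all `γ > 0` such that `m_p / (p+1)^γ` is almost
increasing (the supremum of the empty set being `0`). -/
def gammaIndex (M : ℕ → ℝ) : ENNReal :=
  sSup {t | ∃ γ : ℝ, 0 < γ ∧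
    AlmostIncreasing (fun p => quotients M p / ((p : ℝ) + 1) ^ γ) ∧ t = ENNReal.ofReal γ}

/-- The Riemann surface of the logarithm, in its global holomorphic coordinate `w = log z`:
the point with coordinate `w` has modulus `exp (re w)` and argument `im w`, and lies over the
point `exp w` of the punctured plane. As `exp` is a local biholomorphism, a function on the surface
is holomorphic if and only if it is holomorphic as a function of the coordinate `w`. -/
abbrev LogSurface : Type := ℂ

/-- The projection of the surface onto the punctured plane, `z` seen as a complex number. -/
def LogSurface.proj (w : LogSurface) : ℂ := Complex.exp w

/-- The modulus `|z|` of a point of the surface. -/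
def LogSurface.modulus (w : LogSurface) : ℝ := Real.exp w.re

/-- The argument of a point of the surface, an arbitrary real number. -/
def LogSurface.arg (w : LogSurface) : ℝ := w.im

/-- The unbounded sector `S_γ` of opening `γ π` bisected by direction `0`. -/
def sector (γ : ℝ) : Set LogSurface := {z | |LogSurface.arg z| < γ * Real.pi / 2}

/-- `F` is the uniform `M`-asymptotic expansion of type `1/h` of `f` in `S`. -/
def HasUniformExpansion (M : ℕ → ℝ) (h : ℝ) (S : Set LogSurface) (f : LogSurface → ℂ)
    (F : PowerSeries ℂ) : Prop :=
  ∃ C : ℝ, 0 < C ∧ ∀ p : ℕ, ∀ z ∈ S,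
    ‖f z - ∑ n ∈ Finset.range p, PowerSeries.coeff n F * LogSurface.proj z ^ n‖ ≤
      C * h ^ p * M p * LogSurface.modulus z ^ p

/-- Holomorphic functions on `S` that admit a uniform `M`-asymptotic expansion of type `1/h`.
(A function on `S` is represented by any of its extensions to the surface.) -/
def uniformClass (M : ℕ → ℝ) (h : ℝ) (S : Set LogSurface) : Set (LogSurface → ℂ) :=
  {f | DifferentiableOn ℂ f S ∧ ∃ F : PowerSeries ℂ, HasUniformExpansion M h S f F}

/-- The Beurling class of functions: the intersection of the previous classes over all `h > 0`. -/
def beurlingClass (M : ℕ → ℝ) (S : Set LogSurface) : Set (LogSurface → ℂ) :=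
  {f | ∀ h : ℝ, 0 < h → f ∈ uniformClass M h S}

/-- Formal power series with `sup_p |a_p| / (h^p M_p)` finite. -/
def seriesClass (M : ℕ → ℝ) (h : ℝ) : Set (PowerSeries ℂ) :=
  {F | ∃ C : ℝ, ∀ p : ℕ, ‖PowerSeries.coeff p F‖ ≤ C * (h ^ p * M p)}

/-- The Beurling class of formal power series. -/
def beurlingSeries (M : ℕ → ℝ) : Set (PowerSeries ℂ) :=
  {F | ∀ h : ℝ, 0 < h → F ∈ seriesClass M h}

/-- A uniform expansion in a sector, read along the direction `0`. -/
lemma HasUniformExpansion.on_ray {M : ℕ → ℝ} {h r : ℝ} (hr : 0 < r) {f : LogSurface → ℂ}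
    {F : PowerSeries ℂ} (hF : HasUniformExpansion M h (sector r) f F) :
    ∃ C : ℝ, ∀ p : ℕ, ∀ x : ℝ, 0 < x →
      ‖f (Real.log x) - ∑ n ∈ Finset.range p, PowerSeries.coeff n F * (x : ℂ) ^ n‖ ≤
        C * h ^ p * M p * x ^ p := by
  obtain ⟨C, -, hC⟩ := hF
  refine ⟨C, fun p x hx => ?_⟩
  have hmem : ((Real.log x : ℝ) : ℂ) ∈ sector r := by
    simp only [sector, LogSurface.arg, Set.mem_ofPred_eq, Complex.ofReal_im, abs_zero]
    have := Real.pi_pos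
    positivity
  have h1 := hC p _ hmem
  have e : Complex.exp ((Real.log x : ℝ) : ℂ) = (x : ℂ) := by
    rw [← Complex.ofReal_exp, Real.exp_log hx]
  simpa only [LogSurface.proj, LogSurface.modulus, e, Complex.ofReal_re, Real.exp_log hx] using h1

/-- A number bounded by `B + A x` for all `x > 0` is bounded by `B`. -/
lemma le_of_forall_le_add_mul {a B A : ℝ} (H : ∀ x : ℝ, 0 < x → a ≤ B + A * x) : a ≤ B := by
  have ht : Tendsto (fun x : ℝ => B + A * x) (𝓝[>] 0) (𝓝 B) := by
    have : Tendsto (fun x : ℝ => B + A * x) (𝓝 0) (𝓝 (B + A * 0)) :=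
      (continuous_const.add (continuous_const.mul continuous_id)).tendsto 0
    rw [mul_zero, add_zero] at this
    exact this.mono_left nhdsWithin_le_nhds
  exact ge_of_tendsto ht (eventually_mem_nhdsWithin.mono fun x hx => H x hx)

/-- The coefficients of a uniform expansion satisfy the bounds of the class. -/
lemma HasUniformExpansion.mem_seriesClass {M : ℕ → ℝ} {h r : ℝ} (hr : 0 < r) {f : LogSurface → ℂ}
    {F : PowerSeries ℂ} (hF : HasUniformExpansion M h (sector r) f F) : F ∈ seriesClass M h := by
  obtain ⟨C, hC⟩ := hF.on_ray hr
  refine ⟨C, fun p => ?_⟩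
  refine le_of_forall_le_add_mul (A := C * h ^ (p + 1) * M (p + 1)) fun x hx => ?_
  have h1 := hC p x hx
  have h2 := hC (p + 1) x hx
  rw [Finset.sum_range_succ] at h2
  have h3 : ‖PowerSeries.coeff p F * (x : ℂ) ^ p‖ ≤
      C * h ^ p * M p * x ^ p + C * h ^ (p + 1) * M (p + 1) * x ^ (p + 1) := by
    refine le_trans ?_ (add_le_add h1 h2)
    refine le_trans (le_of_eq ?_) (norm_sub_le _ _)
    congr 1
    ring
  have hxp : 0 < x ^ p := pow_pos hx p
  rw [norm_mul, norm_pow, Complex.norm_real, Real.norm_of_nonneg hx.le] at h3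
  refine le_of_mul_le_mul_right (h3.trans (le_of_eq ?_)) hxp
  ring

/-- The uniform expansion of a function is unique, even between different types. -/
lemma HasUniformExpansion.unique {M : ℕ → ℝ} {h h' r : ℝ} (hr : 0 < r) {f : LogSurface → ℂ}
    {F G : PowerSeries ℂ} (hF : HasUniformExpansion M h (sector r) f F)
    (hG : HasUniformExpansion M h' (sector r) f G) : F = G := by
  obtain ⟨C, hC⟩ := hF.on_ray hr
  obtain ⟨D, hD⟩ := hG.on_ray hr
  ext p
  induction p using Nat.strong_induction_on with
  | _ p ih =>
  have hs : ∀ x : ℂ, ∑ n ∈ Finset.range p, PowerSeries.coeff n F * x ^ n =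
      ∑ n ∈ Finset.range p, PowerSeries.coeff n G * x ^ n := fun x =>
    Finset.sum_congr rfl fun n hn => by rw [ih n (Finset.mem_range.1 hn)]
  have key : ‖PowerSeries.coeff p F - PowerSeries.coeff p G‖ ≤ 0 := by
    refine le_of_forall_le_add_mul
      (A := C * h ^ (p + 1) * M (p + 1) + D * h' ^ (p + 1) * M (p + 1)) fun x hx => ?_
    have h1 := hC (p + 1) x hx
    have h2 := hD (p + 1) x hx
    rw [Finset.sum_range_succ] at h1 h2
    rw [hs] at h1
    have h3 : ‖(PowerSeries.coeff p F - PowerSeries.coeff p G) * (x : ℂ) ^ p‖ ≤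
        D * h' ^ (p + 1) * M (p + 1) * x ^ (p + 1) + C * h ^ (p + 1) * M (p + 1) * x ^ (p + 1) := by
      refine le_trans ?_ (add_le_add h2 h1)
      refine le_trans (le_of_eq ?_) (norm_sub_le _ _)
      congr 1
      ring
    have hxp : 0 < x ^ p := pow_pos hx p
    rw [norm_mul, norm_pow, Complex.norm_real, Real.norm_of_nonneg hx.le] at h3
    refine le_of_mul_le_mul_right (h3.trans (le_of_eq ?_)) hxp
    ring
  exact sub_eq_zero.1 (norm_le_zero_iff.1 key)

/-- A function of the Beurling class has one expansion, of all types. -/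
lemma exists_expansion {M : ℕ → ℝ} {r : ℝ} (hr : 0 < r) {f : LogSurface → ℂ}
    (hf : f ∈ beurlingClass M (sector r)) :
    ∃ F : PowerSeries ℂ, ∀ h : ℝ, 0 < h → HasUniformExpansion M h (sector r) f F := by
  obtain ⟨-, F, hF⟩ := hf 1 one_pos
  refine ⟨F, fun h hh => ?_⟩
  obtain ⟨-, G, hG⟩ := hf h hh
  rwa [hF.unique hr hG]

/-- The asymptotic Borel map between Beurling classes on `S_r`, sending a function to its uniform
asymptotic expansion. -/
def borelMap (M : ℕ → ℝ) (r : ℝ) (hr : 0 < r) (f : beurlingClass M (sector r)) :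
    beurlingSeries M :=
  ⟨(exists_expansion hr f.2).choose, fun h hh =>
    ((exists_expansion hr f.2).choose_spec h hh).mem_seriesClass hr⟩

/-- The surjectivity interval of the Borel map for the Beurling classes. -/
def surjectivityInterval (M : ℕ → ℝ) : Set ℝ :=
  {γ | ∃ hγ : 0 < γ, Function.Surjective (borelMap M γ hγ)}

end

end Ultraholomorphic

/-!
Write `n_k = exp (l k)` and `N_p = n_0 ⋯ n_{p-1}`. If `n_k / (k + 1) ^ s` increases for some
`s > r`, then `∑ n_k ^ (-1 / r)` is finite, and the kernel
`K(z) = ∏ (1 + (z / n_k) ^ (1 / r)) ^ (-r)` converges. On `S_r` the number `(z / n_k) ^ (1 / r)` has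
positive real part, so that each factor is bounded by `min 1 (n_k / |z|)`, and
`|K(z)| |z| ^ j ≤ N_j` for every `j`. The moments
`∫ K(t) t ^ p dt / t` and the `N_p` agree up to geometric factors, so dividing the coefficients of
a series with `|a_p| ≤ C N_p` by the moments makes it convergent near `0`. Integrating its sum, cut
off at a small radius, against `K(t / z)` gives a function asymptotic to the series. By the bounds
on `K` with `j = p - 1, p, p + 1`, the integrand of the `p`-th remainder is, up to geometric
factors, at most `N_p |z| ^ p` for `t / |z|` between `n_{p-1}` and `n_p`, and decays exponentially
outside in the scale of `log t`; (sm) says that the logarithmic length of this interval is absorbed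
by a geometric factor.

For the Beurling classes, the coefficients are dominated by a smaller sequence `N` with
`(N_p / M_p) ^ (1 / p) → 0` to which this construction applies. Its quotients are `θ_p μ_p`, where
`μ` is equivalent to the quotients of `M` and regularly increasing, and `θ` decreases to zero so
slowly that the growth of `μ` is not destroyed.
-/

namespace Ultraholomorphic

noncomputable section

open Filter Topology MeasureTheory

variable {r s : ℝ} {l : ℕ → ℝ}

lemma mem_sector {w : ℂ} : w ∈ sector r ↔ |w.im| < r * Real.pi / 2 := Iff.rfl

lemma isOpen_sector (r : ℝ) : IsOpen (sector r) :=
  isOpen_lt (continuous_abs.comp Complex.continuous_im) continuous_const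

lemma isPreconnected_sector (r : ℝ) : IsPreconnected (sector r) := by
  have h : sector r = {w : ℂ | -(r * Real.pi / 2) < w.im} ∩ {w : ℂ | w.im < r * Real.pi / 2} :=
    Set.ext fun w => mem_sector.trans abs_lt
  rw [h]
  exact ((convex_halfSpace_im_gt _).inter (convex_halfSpace_im_lt _)).isPreconnected

lemma zero_mem_sector (hr : 0 < r) : (0 : ℂ) ∈ sector r := by
  have := Real.pi_pos
  rw [mem_sector, Complex.zero_im, abs_zero]
  positivity

lemma ofReal_sub_mem_sector {w : ℂ} (hw : w ∈ sector r) (x : ℝ) : (x : ℂ) - w ∈ sector r := by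
  rw [mem_sector] at hw ⊢
  simpa using hw

lemma eqOn_sector_of_forall_ofReal (hr : 0 < r) {f g : ℂ → ℂ}
    (hf : DifferentiableOn ℂ f (sector r)) (hg : DifferentiableOn ℂ g (sector r))
    (h : ∀ x : ℝ, f x = g x) : Set.EqOn f g (sector r) := by
  have hreal : Tendsto ((↑) : ℝ → ℂ) (𝓝[≠] 0) (𝓝[≠] 0) := by
    simpa using
      (Complex.continuous_ofReal.continuousWithinAt (s := {0}ᶜ) (x := 0)).tendsto_nhdsWithin
        (t := {0}ᶜ) fun x hx => by simpa using hx
  exact (hf.analyticOnNhd (isOpen_sector r)).eqOn_of_preconnected_of_frequently_eq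
    (hg.analyticOnNhd (isOpen_sector r)) (isPreconnected_sector r) (zero_mem_sector hr)
    (hreal.frequently (Frequently.of_forall h))

section HolomorphicIntegral

variable {α E : Type*} [MeasurableSpace α] {μ : Measure α} [NormedAddCommGroup E] [NormedSpace ℂ E]
  {F : ℂ → α → E} {U : Set ℂ}

lemma aestronglyMeasurable_deriv_of_differentiableOn (hU : IsOpen U)
    (hF : ∀ a, DifferentiableOn ℂ (F · a) U) (hm : ∀ w ∈ U, AEStronglyMeasurable (F w) μ) {w : ℂ}
    (hw : w ∈ U) : AEStronglyMeasurable (fun a => deriv (F · a) w) μ := by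
  have hmem : ∀ᶠ h in 𝓝[≠] (0 : ℂ), w + h ∈ U :=
    nhdsWithin_le_nhds ((continuous_const_add w).continuousAt.preimage_mem_nhds
      (hU.mem_nhds (by simpa using hw)))
  obtain ⟨h, hh, hhU⟩ := exists_seq_forall_of_frequently hmem.frequently
  refine aestronglyMeasurable_of_tendsto_ae atTop
    (fun n => ((hm _ (hhU n)).sub (hm w hw)).const_smul (h n)⁻¹) (Eventually.of_forall fun a => ?_)
  have hd := ((hF a).differentiableAt (hU.mem_nhds hw)).hasDerivAt
  exact (hasDerivAt_iff_tendsto_slope_zero.1 hd).comp hh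

lemma differentiableOn_integral_of_dominated {b : α → ℝ} (hU : IsOpen U)
    (hF : ∀ a, DifferentiableOn ℂ (F · a) U) (hm : ∀ w ∈ U, AEStronglyMeasurable (F w) μ)
    (hb : Integrable b μ) (hFb : ∀ w ∈ U, ∀ a, ‖F w a‖ ≤ b a) :
    DifferentiableOn ℂ (fun w => ∫ a, F w a ∂μ) U := by
  intro w₀ hw₀
  obtain ⟨ε, hε, hball⟩ := Metric.isOpen_iff.1 hU w₀ hw₀
  have hsub : ∀ w ∈ Metric.ball w₀ (ε / 2), Metric.closedBall w (ε / 2) ⊆ U := fun w hw =>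
    (Metric.closedBall_subset_ball' (by linarith [Metric.mem_ball.1 hw])).trans hball
  have hcauchy : ∀ a, ∀ w ∈ Metric.ball w₀ (ε / 2), ‖deriv (F · a) w‖ ≤ b a / (ε / 2) :=
    fun a w hw => Complex.norm_deriv_le_of_forall_mem_sphere_norm_le (half_pos hε)
      ((hF a).diffContOnCl_ball (hsub w hw))
      fun z hz => hFb z (hsub w hw (Metric.sphere_subset_closedBall hz)) a
  have hderiv : ∀ a, ∀ w ∈ Metric.ball w₀ (ε / 2), HasDerivAt (F · a) (deriv (F · a) w) w :=
    fun a w hw => ((hF a).differentiableAt (hU.mem_nhds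
      (hsub w hw (Metric.mem_closedBall_self (half_pos hε).le)))).hasDerivAt
  exact (hasDerivAt_integral_of_dominated_loc_of_deriv_le (Metric.ball_mem_nhds w₀ (half_pos hε))
    (eventually_of_mem (hU.mem_nhds hw₀) hm)
    (hb.mono' (hm w₀ hw₀) (Eventually.of_forall (hFb w₀ hw₀)))
    (aestronglyMeasurable_deriv_of_differentiableOn hU hF hm hw₀)
    (Eventually.of_forall hcauchy) (hb.div_const _)
    (Eventually.of_forall hderiv)).2.differentiableAt.differentiableWithinAt

end HolomorphicIntegral

/-! ### The kernel -/

/-- The sequence with first term `1` and quotients `exp (l k)`. -/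
def weight (l : ℕ → ℝ) (p : ℕ) : ℝ := ∏ k ∈ Finset.range p, Real.exp (l k)

lemma weight_zero (l : ℕ → ℝ) : weight l 0 = 1 := Finset.prod_range_zero _

lemma weight_succ (l : ℕ → ℝ) (p : ℕ) : weight l (p + 1) = weight l p * Real.exp (l p) :=
  Finset.prod_range_succ _ p

lemma weight_pos (l : ℕ → ℝ) (p : ℕ) : 0 < weight l p :=
  Finset.prod_pos fun _ _ => Real.exp_pos _

lemma quotients_weight (l : ℕ → ℝ) (p : ℕ) : quotients (weight l) p = Real.exp (l p) := by
  rw [quotients, weight_succ, mul_div_cancel_left₀ _ (weight_pos l p).ne']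

lemma norm_log_one_add_le_of_re_nonneg {v : ℂ} (hv : 0 ≤ v.re) : ‖Complex.log (1 + v)‖ ≤ ‖v‖ := by
  have hre : ∀ z : ℂ, 0 ≤ z.re → 1 ≤ (1 + z).re := fun z hz => by simpa using hz
  have hderiv : ∀ z ∈ {z : ℂ | 0 ≤ z.re},
      HasDerivWithinAt (fun z => Complex.log (1 + z)) (1 / (1 + z)) {z : ℂ | 0 ≤ z.re} z :=
    fun z hz => (((hasDerivAt_id z).const_add 1).clog
      (Or.inl (one_pos.trans_le (hre z hz)))).hasDerivWithinAt
  have hbound : ∀ z ∈ {z : ℂ | 0 ≤ z.re}, ‖1 / (1 + z)‖ ≤ 1 := fun z hz => by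
    rw [norm_div, norm_one]
    exact div_le_one_of_le₀ ((hre z hz).trans (Complex.re_le_norm _)) (norm_nonneg _)
  simpa using (convex_halfSpace_re_ge 0).norm_image_sub_le_of_norm_hasDerivWithin_le hderiv hbound
    (by simp : (0 : ℂ) ∈ {z : ℂ | 0 ≤ z.re}) hv

lemma norm_le_norm_one_add {v : ℂ} (hv : 0 ≤ v.re) : ‖v‖ ≤ ‖1 + v‖ := by
  rw [← sq_le_sq₀ (norm_nonneg _) (norm_nonneg _), Complex.sq_norm, Complex.sq_norm,
    Complex.normSq_apply, Complex.normSq_apply, Complex.add_re, Complex.add_im, Complex.one_re,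
    Complex.one_im]
  nlinarith

/-- A holomorphic branch on `S_r` of `log (1 + (z / n) ^ (1 / r))`, where `z = exp w` and
`n = exp a`. -/
def logFactor (r a : ℝ) (w : ℂ) : ℂ := Complex.log (1 + Complex.exp ((w - a) / r))

lemma norm_exp_sub_div (r a : ℝ) (w : ℂ) :
    ‖Complex.exp ((w - a) / r)‖ = Real.exp ((w.re - a) / r) := by
  rw [Complex.norm_exp, Complex.div_ofReal_re, Complex.sub_re, Complex.ofReal_re]

lemma re_exp_sub_div_pos (hr : 0 < r) {w : ℂ} (hw : w ∈ sector r) (a : ℝ) :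
    0 < (Complex.exp ((w - a) / r)).re := by
  rw [Complex.exp_re]
  refine mul_pos (Real.exp_pos _) (Real.cos_pos_of_mem_Ioo ?_)
  rw [Complex.div_ofReal_im, Complex.sub_im, Complex.ofReal_im, sub_zero, Set.mem_Ioo,
    lt_div_iff₀ hr, div_lt_iff₀ hr]
  have := abs_lt.1 (mem_sector.1 hw)
  constructor <;> linarith

lemma norm_logFactor_le (hr : 0 < r) {w : ℂ} (hw : w ∈ sector r) (a : ℝ) :
    ‖logFactor r a w‖ ≤ Real.exp (w.re / r) * Real.exp (-a / r) := by
  rw [← Real.exp_add, ← add_div, ← sub_eq_add_neg, ← norm_exp_sub_div]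
  exact norm_log_one_add_le_of_re_nonneg (re_exp_sub_div_pos hr hw a).le

lemma re_logFactor_nonneg (hr : 0 < r) {w : ℂ} (hw : w ∈ sector r) (a : ℝ) :
    0 ≤ (logFactor r a w).re := by
  rw [logFactor, Complex.log_re]
  refine Real.log_nonneg (le_trans ?_ (Complex.re_le_norm _))
  simpa using (re_exp_sub_div_pos hr hw a).le

lemma div_le_re_logFactor (hr : 0 < r) {w : ℂ} (hw : w ∈ sector r) (a : ℝ) :
    (w.re - a) / r ≤ (logFactor r a w).re := by
  have hv := re_exp_sub_div_pos hr hw a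
  rw [logFactor, Complex.log_re, ← Real.log_exp ((w.re - a) / r), ← norm_exp_sub_div]
  exact Real.log_le_log (norm_pos_iff.2 (Complex.exp_ne_zero _)) (norm_le_norm_one_add hv.le)

lemma differentiableOn_logFactor (hr : 0 < r) (a : ℝ) :
    DifferentiableOn ℂ (logFactor r a) (sector r) := by
  intro w hw
  have hf : DifferentiableAt ℂ (fun w : ℂ => 1 + Complex.exp ((w - a) / r)) w := by fun_prop
  refine (hf.clog (Or.inl ?_)).differentiableWithinAt
  rw [Complex.add_re, Complex.one_re]
  linarith [re_exp_sub_div_pos hr hw a]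

/-- The product over `k` of holomorphic branches of `(1 + (z / n_k) ^ (1 / r)) ^ (-r)`, where
`z = exp w` and `n_k = exp (l k)`. It decays at infinity faster than any power of `|z|`. -/
def kernel (r : ℝ) (l : ℕ → ℝ) (w : ℂ) : ℂ := Complex.exp (-r * ∑' k, logFactor r (l k) w)

/-- The kernel on the real axis of the logarithmic coordinate. -/
def realKernel (r : ℝ) (l : ℕ → ℝ) (x : ℝ) : ℝ :=
  Real.exp (-r * ∑' k, Real.log (1 + Real.exp ((x - l k) / r)))

lemma realKernel_pos (r : ℝ) (l : ℕ → ℝ) (x : ℝ) : 0 < realKernel r l x := Real.exp_pos _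

lemma logFactor_ofReal (r a x : ℝ) :
    logFactor r a x = (Real.log (1 + Real.exp ((x - a) / r)) : ℝ) := by
  rw [logFactor, Complex.ofReal_log (by positivity)]
  push_cast
  rfl

lemma kernel_ofReal (r : ℝ) (l : ℕ → ℝ) (x : ℝ) : kernel r l x = realKernel r l x := by
  simp only [kernel, realKernel, logFactor_ofReal]
  push_cast
  rfl

section Summable

variable (hl : Summable fun k => Real.exp (-l k / r))
include hl

lemma summable_logFactor (hr : 0 < r) {w : ℂ} (hw : w ∈ sector r) :
    Summable fun k => logFactor r (l k) w :=
  .of_norm_bounded (hl.mul_left _) fun k => norm_logFactor_le hr hw (l k)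

lemma differentiableOn_kernel (hr : 0 < r) : DifferentiableOn ℂ (kernel r l) (sector r) := by
  intro w₀ hw₀
  set U : Set ℂ := sector r ∩ {w | w.re < w₀.re + 1}
  have hU : IsOpen U :=
    (isOpen_sector r).inter (isOpen_lt Complex.continuous_re continuous_const)
  have hsum : DifferentiableOn ℂ (fun w => ∑' k, logFactor r (l k) w) U := by
    refine Complex.differentiableOn_tsum_of_summable_norm (hl.mul_left (Real.exp ((w₀.re + 1) / r)))
      (fun k => (differentiableOn_logFactor hr (l k)).mono Set.inter_subset_left) hU
      fun k w hw => (norm_logFactor_le hr hw.1 (l k)).trans ?_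
    have : w.re < w₀.re + 1 := hw.2
    gcongr
  have hw₀U : w₀ ∈ U := ⟨hw₀, by simp⟩
  exact ((hsum.differentiableAt (hU.mem_nhds hw₀U)).const_mul _).cexp.differentiableWithinAt

lemma norm_kernel_mul_exp_pow_le (hr : 0 < r) {w : ℂ} (hw : w ∈ sector r) (j : ℕ) :
    ‖kernel r l w‖ * Real.exp w.re ^ j ≤ weight l j := by
  have hs := summable_logFactor hl hr hw
  have hpartial : ∑ k ∈ Finset.range j, (w.re - l k) / r ≤ ∑' k, (logFactor r (l k) w).re :=
    (Finset.sum_le_sum fun k _ => div_le_re_logFactor hr hw (l k)).trans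
      ((Complex.hasSum_re hs.hasSum).summable.sum_le_tsum _
        fun k _ => re_logFactor_nonneg hr hw (l k))
  rw [← Finset.sum_div, div_le_iff₀ hr, Finset.sum_sub_distrib, Finset.sum_const,
    Finset.card_range, nsmul_eq_mul] at hpartial
  rw [kernel, Complex.norm_exp, ← Complex.ofReal_neg, Complex.re_ofReal_mul, Complex.re_tsum hs,
    ← Real.exp_nat_mul, ← Real.exp_add, weight, ← Real.exp_sum, Real.exp_le_exp]
  linarith

lemma norm_kernel_le_one (hr : 0 < r) {w : ℂ} (hw : w ∈ sector r) : ‖kernel r l w‖ ≤ 1 := by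
  simpa [weight_zero] using norm_kernel_mul_exp_pow_le hl hr hw 0

lemma continuous_kernel_sub (hr : 0 < r) {w : ℂ} (hw : w ∈ sector r) :
    Continuous fun x : ℝ => kernel r l (x - w) :=
  (differentiableOn_kernel hl hr).continuousOn.comp_continuous (by fun_prop)
    (ofReal_sub_mem_sector hw)

lemma summable_log_one_add_exp (hr : 0 < r) (x : ℝ) :
    Summable fun k => Real.log (1 + Real.exp ((x - l k) / r)) := by
  have hx : (x : ℂ) ∈ sector r := by simpa using ofReal_sub_mem_sector (zero_mem_sector hr) x
  simpa only [logFactor_ofReal, Complex.summable_ofReal] using summable_logFactor hl hr hx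

lemma antitone_realKernel (hr : 0 < r) : Antitone (realKernel r l) := by
  intro x y hxy
  refine Real.exp_le_exp.2 (mul_le_mul_of_nonpos_left ?_ (neg_nonpos.2 hr.le))
  refine (summable_log_one_add_exp hl hr x).tsum_le_tsum (fun k => ?_)
    (summable_log_one_add_exp hl hr y)
  gcongr

end Summable

/-! ### The transform and its moments -/

/-- The function equal to `1` on `[a, b]` and decaying exponentially outside, when `a ≤ b`. -/
def plateau (a b x : ℝ) : ℝ := min 1 (min (Real.exp (x - a)) (Real.exp (b - x)))

lemma continuous_plateau (a b : ℝ) : Continuous (plateau a b) := by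
  unfold plateau
  fun_prop

lemma plateau_nonneg (a b x : ℝ) : 0 ≤ plateau a b x := by
  unfold plateau
  positivity

lemma plateau_le_one (a b x : ℝ) : plateau a b x ≤ 1 := min_le_left _ _

lemma plateau_le_exp_sub_left (a b x : ℝ) : plateau a b x ≤ Real.exp (x - a) :=
  (min_le_right _ _).trans (min_le_left _ _)

lemma plateau_le_exp_sub_right (a b x : ℝ) : plateau a b x ≤ Real.exp (b - x) :=
  (min_le_right _ _).trans (min_le_right _ _)

lemma integrableOn_exp_sub_Iic (a : ℝ) : IntegrableOn (fun x => Real.exp (x - a)) (Set.Iic a) := by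
  simp only [Real.exp_sub]
  exact (integrableOn_exp_Iic a).div_const _

lemma integral_exp_sub_Iic (a : ℝ) : ∫ x in Set.Iic a, Real.exp (x - a) = 1 := by
  simp only [Real.exp_sub, integral_div, integral_exp_Iic, div_self (Real.exp_ne_zero a)]

lemma integrableOn_exp_sub_Ioi (a b : ℝ) :
    IntegrableOn (fun x => Real.exp (b - x)) (Set.Ioi a) := by
  have h : IntegrableOn (fun x => Real.exp (-x)) (Set.Ioi a) := by
    simpa using exp_neg_integrableOn_Ioi a one_pos
  simp only [sub_eq_add_neg, Real.exp_add]
  exact h.const_mul _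

lemma integral_exp_sub_Ioi (b : ℝ) : ∫ x in Set.Ioi b, Real.exp (b - x) = 1 := by
  simp only [sub_eq_add_neg, Real.exp_add, integral_const_mul, integral_exp_neg_Ioi]
  rw [← Real.exp_add, add_neg_cancel, Real.exp_zero]

lemma integrable_plateau (a b : ℝ) : Integrable (plateau a b) := by
  have hdom : ∀ {S : Set ℝ} {f : ℝ → ℝ}, IntegrableOn f S → (∀ x, plateau a b x ≤ f x) →
      IntegrableOn (plateau a b) S := fun hf hle =>
    Integrable.mono' hf (continuous_plateau a b).aestronglyMeasurable <| Eventually.of_forall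
      fun x => (Real.norm_of_nonneg (plateau_nonneg a b x)).trans_le (hle x)
  rw [← integrableOn_univ, ← Set.Iic_union_Ioi (a := a)]
  exact (hdom (integrableOn_exp_sub_Iic a) (plateau_le_exp_sub_left a b)).union
    (hdom (integrableOn_exp_sub_Ioi a b) (plateau_le_exp_sub_right a b))

lemma integral_plateau_le {a b : ℝ} (hab : a ≤ b) : ∫ x, plateau a b x ≤ 2 + (b - a) := by
  have hi : ∀ s, IntegrableOn (plateau a b) s := fun _ => (integrable_plateau a b).integrableOn
  have hleft : ∫ x in Set.Iic a, plateau a b x ≤ 1 :=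
    (setIntegral_mono (hi _) (integrableOn_exp_sub_Iic a) (plateau_le_exp_sub_left a b)).trans_eq
      (integral_exp_sub_Iic a)
  have hmiddle : ∫ x in Set.Ioc a b, plateau a b x ≤ b - a := by
    refine (setIntegral_mono (hi _) (integrableOn_const (by simp)) (plateau_le_one a b)).trans_eq ?_
    simp [hab]
  have hright : ∫ x in Set.Ioi b, plateau a b x ≤ 1 :=
    (setIntegral_mono (hi _) (integrableOn_exp_sub_Ioi b b) (plateau_le_exp_sub_right a b)).trans_eq
      (integral_exp_sub_Ioi b)
  have hsplit : ∫ x in Set.Ioi a, plateau a b x =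
      (∫ x in Set.Ioc a b, plateau a b x) + ∫ x in Set.Ioi b, plateau a b x := by
    rw [← Set.Ioc_union_Ioi_eq_Ioi hab]
    exact setIntegral_union (Set.Ioc_disjoint_Ioi le_rfl) measurableSet_Ioi (hi _) (hi _)
  rw [← intervalIntegral.integral_Iic_add_Ioi (hi (Set.Iic a)) (hi _), hsplit]
  linarith

lemma plateau_sub_le {u X : ℝ} (hu : |u| ≤ X) (a b x : ℝ) :
    plateau a b (x - u) ≤ Real.exp X * plateau a b x := by
  have hu' := abs_le.1 hu
  have hX : 0 ≤ X := (abs_nonneg u).trans hu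
  rw [plateau, plateau, mul_min_of_nonneg _ _ (Real.exp_pos X).le, mul_one,
    mul_min_of_nonneg _ _ (Real.exp_pos X).le, ← Real.exp_add, ← Real.exp_add]
  refine min_le_min (Real.one_le_exp hX) (min_le_min ?_ ?_) <;>
    exact Real.exp_le_exp.2 (by linarith)

/-- The transform with kernel `kernel r l`, in logarithmic coordinates. -/
def kernelTransform (r : ℝ) (l : ℕ → ℝ) (g : ℝ → ℂ) (w : ℂ) : ℂ :=
  ∫ x : ℝ, kernel r l (x - w) * g x

/-- The moments of the kernel: the factors by which its transform multiplies powers. -/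
def moment (r : ℝ) (l : ℕ → ℝ) (n : ℕ) : ℝ := ∫ x : ℝ, realKernel r l x * Real.exp x ^ n

lemma norm_exp_ofReal_pow (x : ℝ) (n : ℕ) : ‖Complex.exp x ^ n‖ = Real.exp x ^ n := by
  rw [norm_pow, Complex.norm_exp_ofReal]

section Summable

variable (hl : Summable fun k => Real.exp (-l k / r))
include hl

lemma norm_kernel_mul_exp_pow_le_plateau (hr : 0 < r) {w : ℂ} (hw : w ∈ sector r) (p : ℕ) :
    ‖kernel r l w‖ * Real.exp w.re ^ (p + 1) ≤
      weight l (p + 1) * plateau (l p) (l (p + 1)) w.re := by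
  have h : ∀ j, ‖kernel r l w‖ * Real.exp w.re ^ j ≤ weight l j :=
    norm_kernel_mul_exp_pow_le hl hr hw
  have hW := (weight_pos l (p + 1)).le
  rw [plateau, mul_min_of_nonneg _ _ hW, mul_min_of_nonneg _ _ hW, mul_one]
  refine le_min (h (p + 1)) (le_min ?_ ?_)
  · calc ‖kernel r l w‖ * Real.exp w.re ^ (p + 1)
        = ‖kernel r l w‖ * Real.exp w.re ^ p * Real.exp w.re := by rw [pow_succ, mul_assoc]
      _ ≤ weight l p * Real.exp w.re := by gcongr; exact h p
      _ = weight l (p + 1) * Real.exp (w.re - l p) := by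
        rw [weight_succ, Real.exp_sub, mul_assoc, mul_div_cancel₀ _ (Real.exp_ne_zero _)]
  · rw [Real.exp_sub, mul_div_assoc', ← weight_succ, le_div_iff₀ (Real.exp_pos _), mul_assoc,
      ← pow_succ]
    exact h (p + 2)

lemma norm_kernel_sub_mul_exp_pow_le (hr : 0 < r) {w : ℂ} (hw : w ∈ sector r) (p : ℕ) (x : ℝ) :
    ‖kernel r l (x - w)‖ * Real.exp x ^ (p + 1) ≤
      weight l (p + 1) * Real.exp w.re ^ (p + 1) * plateau (l p) (l (p + 1)) (x - w.re) := by
  have hx : Real.exp x = Real.exp (x - w.re) * Real.exp w.re := by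
    rw [← Real.exp_add, sub_add_cancel]
  have h := norm_kernel_mul_exp_pow_le_plateau hl hr (ofReal_sub_mem_sector hw x) p
  rw [Complex.sub_re, Complex.ofReal_re] at h
  rw [hx, mul_pow, ← mul_assoc, mul_right_comm (weight l _)]
  gcongr

lemma differentiableOn_kernelTransform (hr : 0 < r) {g : ℝ → ℂ} (hg : AEStronglyMeasurable g)
    {U : Set ℂ} (hU : IsOpen U) (hUr : U ⊆ sector r) {b : ℝ → ℝ} (hb : Integrable b)
    (hbd : ∀ w ∈ U, ∀ x : ℝ, ‖kernel r l (x - w) * g x‖ ≤ b x) :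
    DifferentiableOn ℂ (kernelTransform r l g) U := by
  refine differentiableOn_integral_of_dominated hU (fun x => ?_) (fun w hw =>
    (continuous_kernel_sub hl hr (hUr hw)).aestronglyMeasurable.mul hg) hb hbd
  exact ((differentiableOn_kernel hl hr).comp (differentiableOn_id.const_sub _)
    fun w hw => ofReal_sub_mem_sector (hUr hw) x).mul_const _

section Bound

variable (hr : 0 < r) {w : ℂ} (hw : w ∈ sector r) (p : ℕ) {g : ℝ → ℂ} {B : ℝ}
  (hgB : ∀ x, ‖g x‖ ≤ B * Real.exp x ^ (p + 1))
include hr hw hgB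

lemma norm_kernel_sub_mul_le (x : ℝ) : ‖kernel r l (x - w) * g x‖ ≤
    B * (weight l (p + 1) * Real.exp w.re ^ (p + 1)) * plateau (l p) (l (p + 1)) (x - w.re) := by
  have hB : 0 ≤ B := nonneg_of_mul_nonneg_left ((norm_nonneg _).trans (hgB 0)) (by positivity)
  calc ‖kernel r l (x - w) * g x‖
      ≤ ‖kernel r l (x - w)‖ * (B * Real.exp x ^ (p + 1)) := by
        rw [norm_mul]
        gcongr
        exact hgB x
    _ = B * (‖kernel r l (x - w)‖ * Real.exp x ^ (p + 1)) := mul_left_comm _ _ _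
    _ ≤ B * (weight l (p + 1) * Real.exp w.re ^ (p + 1) *
          plateau (l p) (l (p + 1)) (x - w.re)) := by
        exact mul_le_mul_of_nonneg_left (norm_kernel_sub_mul_exp_pow_le hl hr hw p x) hB
    _ = _ := (mul_assoc _ _ _).symm

lemma integrable_kernel_sub_mul (hg : AEStronglyMeasurable g) :
    Integrable fun x : ℝ => kernel r l (x - w) * g x :=
  (((integrable_plateau _ _).comp_sub_right w.re).const_mul _).mono'
    ((continuous_kernel_sub hl hr hw).aestronglyMeasurable.mul hg)
    (Eventually.of_forall (norm_kernel_sub_mul_le hl hr hw p hgB))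

lemma norm_kernelTransform_le (hlp : l p ≤ l (p + 1)) : ‖kernelTransform r l g w‖ ≤
    B * (weight l (p + 1) * Real.exp w.re ^ (p + 1)) * (2 + (l (p + 1) - l p)) := by
  have hB : 0 ≤ B := nonneg_of_mul_nonneg_left ((norm_nonneg _).trans (hgB 0)) (by positivity)
  have hW := weight_pos l (p + 1)
  refine (norm_integral_le_of_norm_le
    (((integrable_plateau _ _).comp_sub_right w.re).const_mul _)
    (Eventually.of_forall (norm_kernel_sub_mul_le hl hr hw p hgB))).trans ?_
  rw [integral_const_mul, integral_sub_right_eq_self (plateau (l p) (l (p + 1)))]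
  gcongr
  exact integral_plateau_le hlp

end Bound

lemma integrable_kernel_sub_mul_exp_pow (hr : 0 < r) {w : ℂ} (hw : w ∈ sector r) (p : ℕ) :
    Integrable fun x : ℝ => kernel r l (x - w) * Complex.exp x ^ (p + 1) :=
  integrable_kernel_sub_mul hl hr hw p (B := 1)
    (fun x => by rw [norm_exp_ofReal_pow, one_mul])
    (Continuous.aestronglyMeasurable (by fun_prop))

lemma integrable_realKernel_mul_exp_pow (hr : 0 < r) (p : ℕ) :
    Integrable fun x : ℝ => realKernel r l x * Real.exp x ^ (p + 1) := by
  refine (integrable_kernel_sub_mul_exp_pow hl hr (zero_mem_sector hr) p).re.congr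
    (Eventually.of_forall fun x => ?_)
  beta_reduce
  rw [sub_zero, kernel_ofReal, ← Complex.ofReal_exp, ← Complex.ofReal_pow, ← Complex.ofReal_mul]
  exact Complex.ofReal_re _

lemma moment_pos (hr : 0 < r) (p : ℕ) : 0 < moment r l (p + 1) := by
  have hpos : ∀ x, 0 < realKernel r l x * Real.exp x ^ (p + 1) := fun x =>
    mul_pos (realKernel_pos r l x) (by positivity)
  refine (integral_pos_iff_support_of_nonneg (fun x => (hpos x).le)
    (integrable_realKernel_mul_exp_pow hl hr p)).2 ?_
  rw [Set.eq_univ_of_forall fun x => Function.mem_support.2 (hpos x).ne']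
  simp

lemma differentiableOn_kernelTransform_exp_pow (hr : 0 < r) (p : ℕ) :
    DifferentiableOn ℂ (kernelTransform r l fun x => Complex.exp x ^ (p + 1)) (sector r) := by
  intro w₀ hw₀
  set X : ℝ := |w₀.re| + 1
  set U : Set ℂ := sector r ∩ {w | |w.re| < X}
  have hU : IsOpen U := (isOpen_sector r).inter
    (isOpen_lt (continuous_abs.comp Complex.continuous_re) continuous_const)
  have hbound : ∀ w ∈ U, ∀ x : ℝ, ‖kernel r l (x - w) * Complex.exp x ^ (p + 1)‖ ≤
      weight l (p + 1) * Real.exp X ^ (p + 1) * Real.exp X * plateau (l p) (l (p + 1)) x := by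
    intro w hw x
    have hX : |w.re| < X := hw.2
    have hW := weight_pos l (p + 1)
    rw [norm_mul, norm_exp_ofReal_pow, mul_assoc _ (Real.exp X)]
    refine (norm_kernel_sub_mul_exp_pow_le hl hr hw.1 p x).trans ?_
    gcongr
    · exact plateau_nonneg _ _ _
    · exact (le_abs_self _).trans hX.le
    · exact plateau_sub_le hX.le _ _ x
  exact ((differentiableOn_kernelTransform hl hr (Continuous.aestronglyMeasurable (by fun_prop)) hU
    Set.inter_subset_left ((integrable_plateau _ _).const_mul _) hbound).differentiableAt
    (hU.mem_nhds ⟨hw₀, lt_add_one |w₀.re|⟩)).differentiableWithinAt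

lemma kernelTransform_exp_pow (hr : 0 < r) {w : ℂ} (hw : w ∈ sector r) (p : ℕ) :
    kernelTransform r l (fun x => Complex.exp x ^ (p + 1)) w =
      moment r l (p + 1) * Complex.exp w ^ (p + 1) := by
  refine eqOn_sector_of_forall_ofReal hr (differentiableOn_kernelTransform_exp_pow hl hr p)
    (g := fun w => moment r l (p + 1) * Complex.exp w ^ (p + 1)) (by fun_prop) (fun t => ?_) hw
  have hshift : ∀ x : ℝ, kernel r l (x - t) * Complex.exp x ^ (p + 1) =
      (realKernel r l (x - t) * Real.exp (x - t) ^ (p + 1) : ℝ) * Complex.exp t ^ (p + 1) := by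
    intro x
    rw [← Complex.ofReal_sub, kernel_ofReal]
    push_cast
    rw [mul_assoc, ← mul_pow, ← Complex.exp_add, sub_add_cancel]
  simp only [kernelTransform, hshift]
  rw [integral_mul_const, integral_complex_ofReal,
    integral_sub_right_eq_self fun x => realKernel r l x * Real.exp x ^ (p + 1), moment]

end Summable

/-! ### Comparison of the moments with the weights -/

lemma sum_add_rpow_neg_le {x κ : ℝ} (hx : 0 < x) (hκ : 1 < κ) (n : ℕ) :
    ∑ i ∈ Finset.range n, (x + (i + 1 : ℕ)) ^ (-κ) ≤ x ^ (1 - κ) / (κ - 1) := by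
  have hanti : AntitoneOn (fun y : ℝ => y ^ (-κ)) (Set.Icc x (x + n)) := fun y hy z _ hyz =>
    Real.rpow_le_rpow_of_nonpos (hx.trans_le hy.1) hyz (by linarith)
  have hzero : (0 : ℝ) ∉ Set.uIcc x (x + n) := by
    rw [Set.uIcc_of_le (by simp)]
    exact fun h => hx.not_ge h.1
  refine hanti.sum_le_integral.trans ?_
  rw [integral_rpow (Or.inr ⟨by linarith, hzero⟩), ← neg_div_neg_eq, neg_sub,
    show -(-κ + 1) = κ - 1 by ring, neg_add_eq_sub]
  exact div_le_div_of_nonneg_right (sub_le_self _ (by positivity)) (by linarith)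

section Growth

variable (hl : Monotone fun p : ℕ => l p - s * Real.log (p + 1))
include hl

lemma exp_sub_div_le (hr : 0 < r) {p q : ℕ} (hpq : p ≤ q) :
    Real.exp ((l p - l q) / r) ≤ ((p : ℝ) + 1) ^ (s / r) * ((q : ℝ) + 1) ^ (-(s / r)) := by
  have h := hl hpq
  rw [Real.rpow_def_of_pos (by positivity), Real.rpow_def_of_pos (by positivity), ← Real.exp_add,
    Real.exp_le_exp, div_le_iff₀ hr]
  field_simp
  linarith

lemma sum_exp_sub_div_le (hr : 0 < r) (hrs : r < s) (p n : ℕ) :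
    ∑ i ∈ Finset.range n, Real.exp ((l p - l (i + (p + 1))) / r) ≤ (p + 1) * (r / (s - r)) := by
  have hp : 0 < (p : ℝ) + 1 := by positivity
  have hκ : 1 < s / r := (one_lt_div hr).2 hrs
  calc ∑ i ∈ Finset.range n, Real.exp ((l p - l (i + (p + 1))) / r)
      ≤ ∑ i ∈ Finset.range n,
          ((p : ℝ) + 1) ^ (s / r) * (((p : ℝ) + 1) + (i + 1 : ℕ)) ^ (-(s / r)) := by
        refine Finset.sum_le_sum fun i _ => (exp_sub_div_le hl hr (by omega)).trans_eq ?_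
        congr 2
        push_cast
        ring
    _ ≤ ((p : ℝ) + 1) ^ (s / r) * (((p : ℝ) + 1) ^ (1 - s / r) / (s / r - 1)) := by
        rw [← Finset.mul_sum]
        gcongr
        exact sum_add_rpow_neg_le hp hκ n
    _ = (p + 1) * (r / (s - r)) := by
        rw [mul_div_assoc', ← Real.rpow_add hp, add_sub_cancel, Real.rpow_one, div_sub_one hr.ne',
          div_div_eq_mul_div, mul_div_assoc]

lemma summable_exp_neg_div (hr : 0 < r) (hrs : r < s) : Summable fun k => Real.exp (-l k / r) := by
  have htail : Summable fun i => Real.exp ((l 0 - l (i + (0 + 1))) / r) :=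
    summable_of_sum_range_le (fun _ => (Real.exp_pos _).le) (sum_exp_sub_div_le hl hr hrs 0)
  refine (summable_nat_add_iff 1).1 ((htail.mul_left (Real.exp (-l 0 / r))).congr fun i => ?_)
  rw [← Real.exp_add]
  ring_nf

lemma monotone_of_growth (hs : 0 ≤ s) : Monotone l := by
  intro p q hpq
  have h := hl hpq
  have : s * Real.log (p + 1) ≤ s * Real.log (q + 1) := by gcongr
  linarith

lemma sum_range_log_one_add_exp_le (hr : 0 < r) (hs : 0 ≤ s) (p : ℕ) :
    ∑ k ∈ Finset.range (p + 1), Real.log (1 + Real.exp ((l p - l k) / r)) ≤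
      ∑ k ∈ Finset.range (p + 1), (Real.log 2 + (l p - l k) / r) := by
  refine Finset.sum_le_sum fun k hk => ?_
  have hk : l k ≤ l p := monotone_of_growth hl hs (Nat.lt_succ_iff.1 (Finset.mem_range.1 hk))
  have h1 : 1 ≤ Real.exp ((l p - l k) / r) := Real.one_le_exp (div_nonneg (sub_nonneg.2 hk) hr.le)
  calc Real.log (1 + Real.exp ((l p - l k) / r))
      ≤ Real.log (2 * Real.exp ((l p - l k) / r)) := Real.log_le_log (by positivity) (by linarith)
    _ = Real.log 2 + (l p - l k) / r := by
        rw [Real.log_mul two_ne_zero (Real.exp_ne_zero _), Real.log_exp]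

lemma tsum_log_one_add_exp_le (hr : 0 < r) (hrs : r < s) (p : ℕ) :
    ∑' i, Real.log (1 + Real.exp ((l p - l (i + (p + 1))) / r)) ≤ (p + 1) * (r / (s - r)) := by
  have hlog : ∀ x : ℝ, Real.log (1 + Real.exp x) ≤ Real.exp x := fun x => by
    simpa using Real.log_le_sub_one_of_pos (show 0 < 1 + Real.exp x by positivity)
  exact Real.tsum_le_of_sum_range_le (fun i => Real.log_nonneg (by simp [Real.exp_nonneg]))
    fun n => (Finset.sum_le_sum fun i _ => hlog _).trans (sum_exp_sub_div_le hl hr hrs p n)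

lemma weight_le_mul_realKernel (hr : 0 < r) (hrs : r < s) (p : ℕ) :
    weight l (p + 1) ≤
      Real.exp (l p + (r * Real.log 2 + r * (r / (s - r)))) ^ (p + 1) * realKernel r l (l p) := by
  have hhead := sum_range_log_one_add_exp_le hl hr (hr.trans hrs).le p
  have htail := tsum_log_one_add_exp_le hl hr hrs p
  rw [Finset.sum_add_distrib, ← Finset.sum_div, Finset.sum_sub_distrib, Finset.sum_const,
    Finset.sum_const, Finset.card_range, nsmul_eq_mul, nsmul_eq_mul] at hhead
  have htsum := mul_le_mul_of_nonneg_left (add_le_add hhead htail) hr.le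
  rw [(summable_log_one_add_exp (summable_exp_neg_div hl hr hrs) hr (l p)).sum_add_tsum_nat_add
    (p + 1), mul_add, mul_add, mul_div_cancel₀ _ hr.ne'] at htsum
  rw [weight, realKernel, ← Real.exp_sum, ← Real.exp_nat_mul, ← Real.exp_add, Real.exp_le_exp]
  push_cast at htsum ⊢
  linarith

lemma realKernel_mul_exp_pow_le_moment (hr : 0 < r) (hrs : r < s) (p : ℕ) :
    realKernel r l (l p) * Real.exp (l p - 1) ^ (p + 1) ≤ moment r l (p + 1) := by
  have hsum := summable_exp_neg_div hl hr hrs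
  have hint := integrable_realKernel_mul_exp_pow hsum hr p
  calc realKernel r l (l p) * Real.exp (l p - 1) ^ (p + 1)
      = ∫ _ in Set.Ioc (l p - 1) (l p), realKernel r l (l p) * Real.exp (l p - 1) ^ (p + 1) := by
        simp
    _ ≤ ∫ x in Set.Ioc (l p - 1) (l p), realKernel r l x * Real.exp x ^ (p + 1) := by
        refine setIntegral_mono_on (integrableOn_const (by simp)) hint.integrableOn
          measurableSet_Ioc fun x hx => ?_
        gcongr
        · exact (realKernel_pos r l x).le
        · exact antitone_realKernel hsum hr hx.2
        · exact hx.1.le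
    _ ≤ moment r l (p + 1) := setIntegral_le_integral hint <| Eventually.of_forall fun x =>
        mul_nonneg (realKernel_pos r l x).le (by positivity)

lemma exists_weight_le_pow_mul_moment (hr : 0 < r) (hrs : r < s) :
    ∃ B : ℝ, 0 < B ∧ ∀ p, weight l (p + 1) ≤ B ^ (p + 1) * moment r l (p + 1) := by
  set c : ℝ := r * Real.log 2 + r * (r / (s - r))
  refine ⟨Real.exp (1 + c), Real.exp_pos _, fun p => ?_⟩
  calc weight l (p + 1)
      ≤ Real.exp (l p + (r * Real.log 2 + r * (r / (s - r)))) ^ (p + 1) * realKernel r l (l p) :=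
        weight_le_mul_realKernel hl hr hrs p
    _ = Real.exp (1 + c) ^ (p + 1) * (realKernel r l (l p) * Real.exp (l p - 1) ^ (p + 1)) := by
        rw [mul_left_comm, ← mul_pow, ← Real.exp_add, mul_comm,
          show 1 + c + (l p - 1) = l p + c by ring]
    _ ≤ Real.exp (1 + c) ^ (p + 1) * moment r l (p + 1) := by
        gcongr
        exact realKernel_mul_exp_pow_le_moment hl hr hrs p

end Growth

/-! ### Truncated power series -/

section Geometric

variable {u : ℕ → ℂ} {K y : ℝ} (hu : ∀ n, ‖u n‖ ≤ K * y ^ n)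
include hu

lemma norm_tsum_sub_sum_range_le_of_le_half (hy₀ : 0 ≤ y) (hy : y ≤ 1 / 2) (p : ℕ) :
    ‖∑' n, u n - ∑ n ∈ Finset.range p, u n‖ ≤ 2 * K * (2 * y) ^ p := by
  have hK : 0 ≤ K := by simpa using (norm_nonneg _).trans (hu 0)
  have hy₁ : y < 1 := by linarith
  have hsum : Summable u :=
    .of_norm_bounded ((summable_geometric_of_lt_one hy₀ hy₁).mul_left K) hu
  rw [norm_sub_rev]
  calc ‖∑ n ∈ Finset.range p, u n - ∑' n, u n‖
      ≤ K * y ^ p / (1 - y) := norm_sub_le_of_geometric_bound_of_hasSum hy₁ hu hsum.hasSum p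
    _ ≤ K * (2 * y) ^ p / (1 / 2) := by
        gcongr <;> linarith
    _ = 2 * K * (2 * y) ^ p := by ring

lemma norm_sum_range_le_of_half_le (hy : 1 / 2 ≤ y) (p : ℕ) :
    ‖∑ n ∈ Finset.range p, u n‖ ≤ 2 * K * (2 * y) ^ p := by
  have hK : 0 ≤ K := by simpa using (norm_nonneg _).trans (hu 0)
  calc ‖∑ n ∈ Finset.range p, u n‖
      ≤ ∑ n ∈ Finset.range p, K * (2 * y) ^ p * (1 / 2) ^ n := by
        refine norm_sum_le_of_le _ fun n hn => (hu n).trans ?_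
        have hle : (2 * y) ^ n ≤ (2 * y) ^ p :=
          pow_le_pow_right₀ (by linarith) (Finset.mem_range.1 hn).le
        calc K * y ^ n = K * (2 * y) ^ n * (1 / 2) ^ n := by
              rw [mul_assoc, ← mul_pow, mul_right_comm, mul_one_div_cancel two_ne_zero, one_mul]
          _ ≤ K * (2 * y) ^ p * (1 / 2) ^ n := by gcongr
    _ ≤ K * (2 * y) ^ p * 2 := by
        rw [← Finset.mul_sum]
        gcongr
        exact sum_geometric_two_le p
    _ = 2 * K * (2 * y) ^ p := by ring

end Geometric

/-- The sum of the power series `∑ b n * z ^ (n + 1)` for `z = exp x`, cut off above `x = ρ`. -/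
def truncatedSeries (b : ℕ → ℂ) (ρ : ℝ) : ℝ → ℂ :=
  (Set.Iic ρ).indicator fun x => ∑' n, b n * Complex.exp x ^ (n + 1)

section TruncatedSeries

variable {b : ℕ → ℂ} {B C ρ : ℝ}

lemma norm_mul_exp_pow_le (hb : ∀ n, ‖b n‖ ≤ C * B ^ (n + 1)) (n : ℕ) (x : ℝ) :
    ‖b n * Complex.exp x ^ (n + 1)‖ ≤ C * (B * Real.exp x) * (B * Real.exp x) ^ n := by
  rw [norm_mul, norm_exp_ofReal_pow, mul_assoc C, ← pow_succ', mul_pow, ← mul_assoc]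
  gcongr
  exact hb n

variable (hB : 0 < B) (hb : ∀ n, ‖b n‖ ≤ C * B ^ (n + 1)) (hρ : B * Real.exp ρ = 1 / 2)
include hB hb hρ

lemma aestronglyMeasurable_truncatedSeries : AEStronglyMeasurable (truncatedSeries b ρ) := by
  have hC : 0 ≤ C := nonneg_of_mul_nonneg_left ((norm_nonneg _).trans (hb 0)) (by positivity)
  refine (aestronglyMeasurable_indicator_iff measurableSet_Iic).2
    (ContinuousOn.aestronglyMeasurable ?_ measurableSet_Iic)
  refine continuousOn_tsum (u := fun n => C * (1 / 2) * (1 / 2 : ℝ) ^ n) (fun n => by fun_prop)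
    (summable_geometric_two.mul_left _) fun n x (hx : x ≤ ρ) =>
      (norm_mul_exp_pow_le hb n x).trans ?_
  rw [← hρ]
  gcongr

lemma norm_truncatedSeries_sub_le (p : ℕ) (x : ℝ) :
    ‖truncatedSeries b ρ x - ∑ n ∈ Finset.range p, b n * Complex.exp x ^ (n + 1)‖ ≤
      2 * C * B * (2 * B) ^ p * Real.exp x ^ (p + 1) := by
  have hterm : ∀ n, ‖b n * Complex.exp x ^ (n + 1)‖ ≤
      C * (B * Real.exp x) * (B * Real.exp x) ^ n := fun n => norm_mul_exp_pow_le hb n x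
  rw [show 2 * C * B * (2 * B) ^ p * Real.exp x ^ (p + 1) =
    2 * (C * (B * Real.exp x)) * (2 * (B * Real.exp x)) ^ p by ring]
  rcases le_or_gt x ρ with hx | hx
  · rw [truncatedSeries, Set.indicator_of_mem (Set.mem_Iic.2 hx)]
    exact norm_tsum_sub_sum_range_le_of_le_half hterm (by positivity) (by rw [← hρ]; gcongr) p
  · rw [truncatedSeries, Set.indicator_of_notMem (Set.notMem_Iic.2 hx), zero_sub, norm_neg]
    exact norm_sum_range_le_of_half_le hterm (by rw [← hρ]; gcongr) p

lemma integrable_truncatedSeries : Integrable (truncatedSeries b ρ) := by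
  refine (integrable_indicator_iff measurableSet_Iic).2 ?_
  refine Integrable.mono' ((integrableOn_exp_Iic ρ).const_mul (2 * C * B))
    ((aestronglyMeasurable_indicator_iff measurableSet_Iic).1
      (aestronglyMeasurable_truncatedSeries hB hb hρ))
    ((ae_restrict_iff' measurableSet_Iic).2 (Eventually.of_forall fun x hx => ?_))
  simpa [truncatedSeries, Set.indicator_of_mem hx] using
    norm_truncatedSeries_sub_le hB hb hρ 0 x

end TruncatedSeries

/-! ### The Borel–Laplace sum -/

section Summable

variable (hl : Summable fun k => Real.exp (-l k / r)) (hr : 0 < r)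
include hl hr

lemma norm_kernel_sub_mul_le_norm {w : ℂ} (hw : w ∈ sector r) (g : ℝ → ℂ) (x : ℝ) :
    ‖kernel r l (x - w) * g x‖ ≤ ‖g x‖ := by
  rw [norm_mul]
  exact mul_le_of_le_one_left (norm_nonneg _)
    (norm_kernel_le_one hl hr (ofReal_sub_mem_sector hw x))

lemma integrable_kernel_sub_mul_of_integrable {w : ℂ} (hw : w ∈ sector r) {g : ℝ → ℂ}
    (hg : Integrable g) : Integrable fun x : ℝ => kernel r l (x - w) * g x :=
  hg.norm.mono' ((continuous_kernel_sub hl hr hw).aestronglyMeasurable.mul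
    hg.aestronglyMeasurable) (Eventually.of_forall (norm_kernel_sub_mul_le_norm hl hr hw g))

lemma norm_kernelTransform_le_integral_norm {w : ℂ} (hw : w ∈ sector r) {g : ℝ → ℂ}
    (hg : Integrable g) : ‖kernelTransform r l g w‖ ≤ ∫ x, ‖g x‖ :=
  norm_integral_le_of_norm_le hg.norm
    (Eventually.of_forall (norm_kernel_sub_mul_le_norm hl hr hw g))

lemma kernelTransform_sub_sum {w : ℂ} (hw : w ∈ sector r) {g : ℝ → ℂ} (hg : Integrable g)
    (b : ℕ → ℂ) (p : ℕ) :
    kernelTransform r l (fun x => g x - ∑ n ∈ Finset.range p, b n * Complex.exp x ^ (n + 1)) w =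
      kernelTransform r l g w -
        ∑ n ∈ Finset.range p, b n * (moment r l (n + 1) * Complex.exp w ^ (n + 1)) := by
  have hterm : ∀ n ∈ Finset.range p, Integrable fun x : ℝ =>
      b n * (kernel r l (x - w) * Complex.exp x ^ (n + 1)) := fun n _ =>
    (integrable_kernel_sub_mul_exp_pow hl hr hw n).const_mul (b n)
  simp only [kernelTransform, mul_sub, Finset.mul_sum, mul_left_comm _ (b _)]
  rw [integral_sub (integrable_kernel_sub_mul_of_integrable hl hr hw hg)
    (integrable_finsetSum _ hterm), integral_finsetSum _ hterm]
  simp only [integral_const_mul, ← kernelTransform_exp_pow hl hr hw, kernelTransform]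

end Summable

/-- The coefficients of the formal Borel transform of `F`, in which the powers of the variable are
divided by the moments of the kernel. -/
def formalBorel (r : ℝ) (l : ℕ → ℝ) (F : PowerSeries ℂ) (n : ℕ) : ℂ :=
  PowerSeries.coeff (n + 1) F / moment r l (n + 1)

/-- The Borel–Laplace sum of `F`, computed from its formal Borel transform cut off above `ρ`. -/
def truncatedBorelSum (r : ℝ) (l : ℕ → ℝ) (F : PowerSeries ℂ) (ρ : ℝ) (w : ℂ) : ℂ :=
  PowerSeries.coeff 0 F + kernelTransform r l (truncatedSeries (formalBorel r l F) ρ) w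

lemma truncatedBorelSum_sub_sum (hl : Summable fun k => Real.exp (-l k / r)) (hr : 0 < r)
    {w : ℂ} (hw : w ∈ sector r) {F : PowerSeries ℂ} {ρ : ℝ}
    (hF : Integrable (truncatedSeries (formalBorel r l F) ρ)) (p : ℕ) :
    truncatedBorelSum r l F ρ w -
        ∑ n ∈ Finset.range (p + 1), PowerSeries.coeff n F * Complex.exp w ^ n =
      kernelTransform r l (fun x => truncatedSeries (formalBorel r l F) ρ x -
        ∑ n ∈ Finset.range p, formalBorel r l F n * Complex.exp x ^ (n + 1)) w := by
  have hcancel : ∀ n, formalBorel r l F n * (moment r l (n + 1) * Complex.exp w ^ (n + 1)) =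
      PowerSeries.coeff (n + 1) F * Complex.exp w ^ (n + 1) := fun n => by
    rw [formalBorel, ← mul_assoc,
      div_mul_cancel₀ _ (Complex.ofReal_ne_zero.2 (moment_pos hl hr n).ne')]
  rw [kernelTransform_sub_sum hl hr hw hF, Finset.sum_range_succ', truncatedBorelSum]
  simp only [hcancel, pow_zero, mul_one]
  ring

section Growth

variable (hl : Monotone fun p : ℕ => l p - s * Real.log (p + 1)) (hr : 0 < r) (hrs : r < s)
include hl hr hrs

lemma exists_norm_formalBorel_le {F : PowerSeries ℂ} (hF : F ∈ seriesClass (weight l) 1) :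
    ∃ C : ℝ, ∃ B : ℝ, 0 < B ∧ ∀ n, ‖formalBorel r l F n‖ ≤ C * B ^ (n + 1) := by
  obtain ⟨C, hC⟩ := hF
  obtain ⟨B, hB, hBm⟩ := exists_weight_le_pow_mul_moment hl hr hrs
  have hC₀ : 0 ≤ C := by simpa [weight_zero] using (norm_nonneg _).trans (hC 0)
  refine ⟨C, B, hB, fun n => ?_⟩
  have hm := moment_pos (summable_exp_neg_div hl hr hrs) hr n
  rw [formalBorel, norm_div, Complex.norm_real, Real.norm_of_nonneg hm.le, div_le_iff₀ hm,
    mul_assoc]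
  calc ‖PowerSeries.coeff (n + 1) F‖
      ≤ C * weight l (n + 1) := by simpa using hC (n + 1)
    _ ≤ C * (B ^ (n + 1) * moment r l (n + 1)) := mul_le_mul_of_nonneg_left (hBm n) hC₀

section Bound

variable {F : PowerSeries ℂ} {B C ρ : ℝ} (hB : 0 < B)
  (hF : ∀ n, ‖formalBorel r l F n‖ ≤ C * B ^ (n + 1)) (hρ : B * Real.exp ρ = 1 / 2)
include hB hF hρ

lemma norm_truncatedBorelSum_sub_le {w : ℂ} (hw : w ∈ sector r) (p : ℕ) :
    ‖truncatedBorelSum r l F ρ w -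
        ∑ n ∈ Finset.range (p + 1), PowerSeries.coeff n F * Complex.exp w ^ n‖ ≤
      C * (2 * B) ^ (p + 1) * (weight l (p + 1) * Real.exp w.re ^ (p + 1)) *
        (2 + (l (p + 1) - l p)) := by
  have hsum := summable_exp_neg_div hl hr hrs
  rw [truncatedBorelSum_sub_sum hsum hr hw (integrable_truncatedSeries hB hF hρ)]
  refine (norm_kernelTransform_le hsum hr hw p (norm_truncatedSeries_sub_le hB hF hρ p)
    (monotone_of_growth hl (hr.trans hrs).le p.le_succ)).trans_eq ?_
  ring

lemma hasUniformExpansion_truncatedBorelSum (hsm : HasShiftedMoments (weight l)) :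
    ∃ A : ℝ, 0 < A ∧
      HasUniformExpansion (weight l) A (sector r) (truncatedBorelSum r l F ρ) F := by
  obtain ⟨C₀, hC₀, H, hH, hsm⟩ := hsm
  have hC : 0 ≤ C := nonneg_of_mul_nonneg_left ((norm_nonneg _).trans (hF 0)) (by positivity)
  set K : ℝ := ‖PowerSeries.coeff 0 F‖ + ∫ x, ‖truncatedSeries (formalBorel r l F) ρ x‖
  have hK : 0 ≤ K := by positivity
  refine ⟨2 * B * H, by positivity, K + C * (2 + C₀) + 1, by positivity, fun p w hw => ?_⟩
  have hW := weight_pos l p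
  rw [LogSurface.modulus, LogSurface.proj]
  cases p with
  | zero =>
    have hbdd : ‖truncatedBorelSum r l F ρ w‖ ≤ K :=
      (norm_add_le _ _).trans <| add_le_add_right (norm_kernelTransform_le_integral_norm
        (summable_exp_neg_div hl hr hrs) hr hw (integrable_truncatedSeries hB hF hρ)) _
    simp only [Finset.range_zero, Finset.sum_empty, sub_zero, pow_zero, mul_one, weight_zero]
    linarith [show 0 ≤ C * (2 + C₀) by positivity]
  | succ p =>
    have hjump : 2 + (l (p + 1) - l p) ≤ (2 + C₀) * H ^ (p + 1) := by
      have h := hsm p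
      rw [quotients_weight, quotients_weight, ← Real.exp_sub, Real.log_exp] at h
      linarith [one_le_pow₀ hH.le (n := p + 1)]
    calc _ ≤ C * (2 * B) ^ (p + 1) * (weight l (p + 1) * Real.exp w.re ^ (p + 1)) *
          (2 + (l (p + 1) - l p)) := norm_truncatedBorelSum_sub_le hl hr hrs hB hF hρ hw p
      _ ≤ C * (2 * B) ^ (p + 1) * (weight l (p + 1) * Real.exp w.re ^ (p + 1)) *
          ((2 + C₀) * H ^ (p + 1)) := by gcongr
      _ = C * (2 + C₀) * (2 * B * H) ^ (p + 1) * weight l (p + 1) * Real.exp w.re ^ (p + 1) := by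
          rw [mul_pow (2 * B)]
          ring
      _ ≤ (K + C * (2 + C₀) + 1) * (2 * B * H) ^ (p + 1) * weight l (p + 1) *
          Real.exp w.re ^ (p + 1) := by
          gcongr
          linarith

end Bound

theorem exists_hasUniformExpansion_weight (hsm : HasShiftedMoments (weight l))
    {F : PowerSeries ℂ} (hF : F ∈ seriesClass (weight l) 1) :
    ∃ f : LogSurface → ℂ, DifferentiableOn ℂ f (sector r) ∧
      ∃ A : ℝ, 0 < A ∧ HasUniformExpansion (weight l) A (sector r) f F := by
  obtain ⟨C, B, hB, hb⟩ := exists_norm_formalBorel_le hl hr hrs hF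
  have hρ : B * Real.exp (Real.log (1 / (2 * B))) = 1 / 2 := by
    rw [Real.exp_log (by positivity)]
    field_simp
  have hsum := summable_exp_neg_div hl hr hrs
  have hint := integrable_truncatedSeries hB hb hρ
  exact ⟨truncatedBorelSum r l F (Real.log (1 / (2 * B))),
    (differentiableOn_kernelTransform hsum hr hint.aestronglyMeasurable (isOpen_sector r) subset_rfl
      hint.norm fun w hw => norm_kernel_sub_mul_le_norm hsum hr hw _).const_add _,
    hasUniformExpansion_truncatedBorelSum hl hr hrs hB hb hρ hsm⟩

end Growth

/-! ### Slowly decreasing factors -/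

/-- The relation `N ◁ M` between sequences: `(N p / M p) ^ (1 / p)` tends to zero. It is phrased
without roots, which also bounds the first terms. -/
def IsStrictlyDominated (N M : ℕ → ℝ) : Prop :=
  ∀ t : ℝ, 0 < t → ∃ C : ℝ, 0 < C ∧ ∀ p, N p ≤ C * t ^ p * M p

lemma IsStrictlyDominated.of_le_mul_pow_mul {N M W : ℕ → ℝ} (hNM : IsStrictlyDominated N M)
    {K a : ℝ} (hK : 0 < K) (ha : 0 < a) (hMW : ∀ p, M p ≤ K * a ^ p * W p) :
    IsStrictlyDominated N W := by
  intro t ht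
  obtain ⟨C, hC, hNM⟩ := hNM (t / a) (by positivity)
  refine ⟨C * K, by positivity, fun p => ?_⟩
  calc N p ≤ C * (t / a) ^ p * M p := hNM p
    _ ≤ C * (t / a) ^ p * (K * a ^ p * W p) := by
        gcongr
        exact hMW p
    _ = C * K * t ^ p * W p := by
        rw [div_pow]
        field_simp

lemma HasUniformExpansion.of_isStrictlyDominated {N M : ℕ → ℝ} {A : ℝ} (hA : 0 < A)
    {S : Set LogSurface} {f : LogSurface → ℂ} {F : PowerSeries ℂ}
    (hf : HasUniformExpansion N A S f F) (hNM : IsStrictlyDominated N M) {h : ℝ} (hh : 0 < h) :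
    HasUniformExpansion M h S f F := by
  obtain ⟨D, hD, hf⟩ := hf
  obtain ⟨C, hC, hNM⟩ := hNM (h / A) (by positivity)
  refine ⟨D * C, by positivity, fun p w hw => (hf p w hw).trans ?_⟩
  rw [LogSurface.modulus]
  calc D * A ^ p * N p * Real.exp w.re ^ p
      ≤ D * A ^ p * (C * (h / A) ^ p * M p) * Real.exp w.re ^ p := by
        gcongr
        exact hNM p
    _ = D * C * h ^ p * M p * Real.exp w.re ^ p := by
        rw [div_pow]
        field_simp

lemma AlmostIncreasing.exists_monotone_le {c : ℕ → ℝ} (h : AlmostIncreasing c)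
    (hc : ∀ p, 0 ≤ c p) :
    ∃ a : ℝ, 0 < a ∧ ∃ d : ℕ → ℝ, Monotone d ∧ (∀ p, d p ≤ c p) ∧ ∀ p, c p ≤ a * d p := by
  obtain ⟨a, ha, h⟩ := h
  have hbdd : ∀ p, BddBelow (Set.range fun k => c (p + k)) := fun p =>
    ⟨0, Set.forall_mem_range.2 fun k => hc (p + k)⟩
  refine ⟨a, ha, fun p => ⨅ k, c (p + k), monotone_nat_of_le_succ fun p => le_ciInf fun k => ?_,
    fun p => ciInf_le (hbdd p) 0, fun p => ?_⟩
  · rw [Nat.add_right_comm]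
    exact ciInf_le (hbdd p) (k + 1)
  · rw [← div_le_iff₀' ha]
    exact le_ciInf fun k => (div_le_iff₀' ha).2 (h p (p + k) (Nat.le_add_right p k))

/-- A decreasing majorant of `σ` whose product with the increasing sequence `g` is increasing. -/
def slowMajorant (g σ : ℕ → ℝ) (p : ℕ) : ℝ := ⨆ k, σ k * min 1 (g k / g p)

section SlowMajorant

variable {g σ : ℕ → ℝ} (hσ : ∀ k, 0 ≤ σ k)
include hσ

lemma bddAbove_range_mul_min (hb : BddAbove (Set.range σ)) (p : ℕ) :
    BddAbove (Set.range fun k => σ k * min 1 (g k / g p)) := by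
  obtain ⟨S, hS⟩ := hb
  exact ⟨S, Set.forall_mem_range.2 fun k =>
    (mul_le_of_le_one_right (hσ k) (min_le_left _ _)).trans (hS ⟨k, rfl⟩)⟩

variable (hg₀ : ∀ k, 0 < g k)
include hg₀

lemma le_slowMajorant (hb : BddAbove (Set.range σ)) (p : ℕ) : σ p ≤ slowMajorant g σ p := by
  simpa [slowMajorant, div_self (hg₀ p).ne'] using
    le_ciSup (bddAbove_range_mul_min (g := g) hσ hb p) p

lemma antitone_slowMajorant (hg : Monotone g) (hb : BddAbove (Set.range σ)) :
    Antitone (slowMajorant g σ) := by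
  refine fun p q hpq => ciSup_mono (bddAbove_range_mul_min hσ hb p) fun k => ?_
  have := hg₀ p
  have := hg₀ k
  have := hσ k
  have := hg hpq
  gcongr

lemma monotone_slowMajorant_mul (hg : Monotone g) (hb : BddAbove (Set.range σ)) :
    Monotone fun p => slowMajorant g σ p * g p := by
  have hmul : ∀ p, slowMajorant g σ p * g p = ⨆ k, σ k * min (g p) (g k) := fun p => by
    rw [slowMajorant, Real.iSup_mul_of_nonneg (hg₀ p).le]
    simp only [mul_assoc, min_mul_of_nonneg _ _ (hg₀ p).le, one_mul,
      div_mul_cancel₀ _ (hg₀ p).ne']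
  intro p q hpq
  obtain ⟨S, hS⟩ := hb
  simp only [hmul]
  refine ciSup_mono ⟨S * g q, Set.forall_mem_range.2 fun k => ?_⟩ fun k =>
    mul_le_mul_of_nonneg_left (min_le_min_right _ (hg hpq)) (hσ k)
  exact mul_le_mul (hS ⟨k, rfl⟩) (min_le_left _ _) (le_min (hg₀ q).le (hg₀ k).le)
    ((hσ k).trans (hS ⟨k, rfl⟩))

lemma tendsto_slowMajorant (hg : Tendsto g atTop atTop) (hσ₀ : Tendsto σ atTop (𝓝 0)) :
    Tendsto (slowMajorant g σ) atTop (𝓝 0) := by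
  have hnonneg : ∀ p, 0 ≤ slowMajorant g σ p := fun p =>
    (hσ p).trans (le_slowMajorant hσ hg₀ hσ₀.bddAbove_range p)
  refine tendsto_order.2 ⟨fun a ha => Eventually.of_forall fun p => ha.trans_le (hnonneg p),
    fun ε hε => ?_⟩
  obtain ⟨N, hN⟩ := eventually_atTop.1 (hσ₀.eventually_lt_const (half_pos hε))
  have hsmall : ∀ᶠ p in atTop, ∀ k ∈ Finset.range N, σ k * (g k / g p) < ε / 2 := by
    refine (Finset.eventually_all _).2 fun k _ => ?_
    have hlim : Tendsto (fun p => σ k * (g k / g p)) atTop (𝓝 0) := by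
      simpa using (hg.const_div_atTop (g k)).const_mul (σ k)
    exact hlim.eventually_lt_const (half_pos hε)
  filter_upwards [hsmall] with p hp
  refine (ciSup_le fun k => ?_).trans_lt (half_lt_self hε)
  rcases lt_or_ge k N with hk | hk
  · exact (mul_le_mul_of_nonneg_left (min_le_right _ _) (hσ k)).trans
      (hp k (Finset.mem_range.2 hk)).le
  · exact (mul_le_of_le_one_right (hσ k) (min_le_left _ _)).trans (hN k hk).le

end SlowMajorant

lemma IsStrictlyDominated.tendsto_root {a W : ℕ → ℝ} (h : IsStrictlyDominated a W)
    (ha : ∀ n, 0 ≤ a n) (hW : ∀ n, 0 < W n) :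
    Tendsto (fun n : ℕ => (a n / W n) ^ (n : ℝ)⁻¹) atTop (𝓝 0) := by
  have hε : ∀ n, 0 ≤ a n / W n := fun n => div_nonneg (ha n) (hW n).le
  refine tendsto_order.2 ⟨fun b hb => Eventually.of_forall fun n =>
    hb.trans_le (Real.rpow_nonneg (hε n) _), fun t ht => ?_⟩
  obtain ⟨C, -, hC⟩ := h (t / 4) (by positivity)
  have hlim : Tendsto (fun n : ℕ => C * (1 / 2 : ℝ) ^ n) atTop (𝓝 0) := by
    simpa using (tendsto_pow_atTop_nhds_zero_of_lt_one (by norm_num)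
      (by norm_num : (1 / 2 : ℝ) < 1)).const_mul C
  filter_upwards [hlim.eventually_le_const one_pos, eventually_ne_atTop 0] with n hn hn₀
  have hle : a n / W n ≤ (t / 2) ^ n := by
    rw [div_le_iff₀ (hW n)]
    calc a n ≤ C * (t / 4) ^ n * W n := hC n
      _ = C * (1 / 2) ^ n * (t / 2) ^ n * W n := by
          rw [mul_assoc C ((1 / 2) ^ n), ← mul_pow, show 1 / 2 * (t / 2) = t / 4 by ring]
      _ ≤ (t / 2) ^ n * W n := by
          have := hW n
          gcongr
          exact mul_le_of_le_one_left (by positivity) hn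
  calc (a n / W n) ^ (n : ℝ)⁻¹ ≤ ((t / 2) ^ n) ^ (n : ℝ)⁻¹ :=
        Real.rpow_le_rpow (hε n) hle (by positivity)
    _ = t / 2 := Real.pow_rpow_inv_natCast (by positivity) hn₀
    _ < t := half_lt_self ht

lemma pow_le_prod_range_of_antitone {θ : ℕ → ℝ} (hθ : Antitone θ) (h₀ : ∀ p, 0 ≤ θ p) (n : ℕ) :
    θ n ^ n ≤ ∏ k ∈ Finset.range n, θ k := by
  simpa using Finset.prod_le_prod (s := Finset.range n) (f := fun _ => θ n) (fun _ _ => h₀ n)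
    fun k hk => hθ (Finset.mem_range.1 hk).le

lemma IsStrictlyDominated.exists_slow_factors {a W : ℕ → ℝ} (h : IsStrictlyDominated a W)
    (ha : ∀ n, 0 ≤ a n) (hW : ∀ n, 0 < W n) {g : ℕ → ℝ} (hg : Monotone g) (hg₀ : ∀ k, 0 < g k)
    (hg_top : Tendsto g atTop atTop) :
    ∃ θ : ℕ → ℝ, (∀ p, 0 < θ p) ∧ Antitone θ ∧ Tendsto θ atTop (𝓝 0) ∧
      (Monotone fun p => θ p * g p) ∧
      ∃ C : ℝ, ∀ n, a n ≤ C * (∏ k ∈ Finset.range n, θ k) * W n := by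
  have hroot : ∀ n, 0 ≤ (a n / W n) ^ (n : ℝ)⁻¹ := fun n =>
    Real.rpow_nonneg (div_nonneg (ha n) (hW n).le) _
  set σ : ℕ → ℝ := fun n => (a n / W n) ^ (n : ℝ)⁻¹ + 1 / (n + 1)
  have hσ_pos : ∀ n, 0 < σ n := fun n => add_pos_of_nonneg_of_pos (hroot n) (by positivity)
  have hσ₀ : ∀ n, 0 ≤ σ n := fun n => (hσ_pos n).le
  have hσ_lim : Tendsto σ atTop (𝓝 0) := by
    simpa [σ] using (h.tendsto_root ha hW).add tendsto_one_div_add_atTop_nhds_zero_nat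
  have hσ_le := le_slowMajorant hσ₀ hg₀ hσ_lim.bddAbove_range
  have hanti := antitone_slowMajorant hσ₀ hg₀ hg hσ_lim.bddAbove_range
  have hpos : ∀ p, 0 < slowMajorant g σ p := fun p => (hσ_pos p).trans_le (hσ_le p)
  refine ⟨slowMajorant g σ, hpos, hanti, tendsto_slowMajorant hσ₀ hg₀ hg_top hσ_lim,
    monotone_slowMajorant_mul hσ₀ hg₀ hg hσ_lim.bddAbove_range, max 1 (a 0 / W 0), fun n => ?_⟩
  rw [← div_le_iff₀ (hW n)]
  rcases eq_or_ne n 0 with rfl | hn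
  · simp
  have hroot_le : (a n / W n) ^ (n : ℝ)⁻¹ ≤ slowMajorant g σ n :=
    (le_add_of_nonneg_right (by positivity)).trans (hσ_le n)
  calc a n / W n = ((a n / W n) ^ (n : ℝ)⁻¹) ^ n :=
        (Real.rpow_inv_natCast_pow (div_nonneg (ha n) (hW n).le) hn).symm
    _ ≤ slowMajorant g σ n ^ n := pow_le_pow_left₀ (hroot n) hroot_le n
    _ ≤ ∏ k ∈ Finset.range n, slowMajorant g σ k :=
        pow_le_prod_range_of_antitone hanti (fun p => (hpos p).le) n
    _ ≤ _ := le_mul_of_one_le_left (Finset.prod_nonneg fun k _ => (hpos k).le) (le_max_left _ _)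

lemma exists_prod_range_le_mul_pow {θ : ℕ → ℝ} (hpos : ∀ p, 0 < θ p)
    (hθ : Tendsto θ atTop (𝓝 0)) {t : ℝ} (ht : 0 < t) :
    ∃ C : ℝ, 0 < C ∧ ∀ p, ∏ k ∈ Finset.range p, θ k ≤ C * t ^ p := by
  have hP : ∀ p, 0 < ∏ k ∈ Finset.range p, θ k / t := fun p =>
    Finset.prod_pos fun k _ => div_pos (hpos k) ht
  have hsum : Summable fun p => ∏ k ∈ Finset.range p, θ k / t := by
    refine summable_of_ratio_test_tendsto_lt_one (l := 0) one_pos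
      (Eventually.of_forall fun p => (hP p).ne') ?_
    have hlim : Tendsto (fun p => θ p / t) atTop (𝓝 0) := by simpa using hθ.div_const t
    refine hlim.congr fun p => ?_
    rw [Real.norm_of_nonneg (hP _).le, Real.norm_of_nonneg (hP _).le, Finset.prod_range_succ,
      mul_div_cancel_left₀ _ (hP p).ne']
  obtain ⟨C, hC⟩ := hsum.tendsto_atTop_zero.bddAbove_range
  have hle : ∀ p, ∏ k ∈ Finset.range p, θ k / t ≤ C := fun p => hC ⟨p, rfl⟩
  refine ⟨C, (hP 0).trans_le (hle 0), fun p => ?_⟩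
  have h := hle p
  rwa [Finset.prod_div_distrib, Finset.prod_const, Finset.card_range,
    div_le_iff₀ (pow_pos ht p)] at h

/-! ### Passage to a smaller weight sequence -/

lemma quotients_pos {M : ℕ → ℝ} (hpos : ∀ p, 0 < M p) (p : ℕ) : 0 < quotients M p :=
  div_pos (hpos (p + 1)) (hpos p)

lemma eq_mul_prod_quotients {M : ℕ → ℝ} (hpos : ∀ p, 0 < M p) (p : ℕ) :
    M p = M 0 * ∏ k ∈ Finset.range p, quotients M k := by
  induction p with
  | zero => simp
  | succ p ih =>
    rw [Finset.prod_range_succ, ← mul_assoc, ← ih, quotients, mul_div_cancel₀ _ (hpos p).ne']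

lemma le_mul_pow_mul_prod_of_quotients_le {M μ : ℕ → ℝ} (hpos : ∀ p, 0 < M p) {a : ℝ}
    (h : ∀ p, quotients M p ≤ a * μ p) (p : ℕ) :
    M p ≤ M 0 * a ^ p * ∏ k ∈ Finset.range p, μ k := by
  have hprod : ∏ k ∈ Finset.range p, quotients M k ≤ ∏ k ∈ Finset.range p, a * μ k :=
    Finset.prod_le_prod (fun k _ => (quotients_pos hpos k).le) fun k _ => h k
  rw [Finset.prod_mul_distrib, Finset.prod_const, Finset.card_range] at hprod
  rw [eq_mul_prod_quotients hpos p, mul_assoc]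
  exact mul_le_mul_of_nonneg_left hprod (hpos 0).le

lemma prod_le_div_of_le_quotients {M μ : ℕ → ℝ} (hpos : ∀ p, 0 < M p) (hμ : ∀ p, 0 ≤ μ p)
    (h : ∀ p, μ p ≤ quotients M p) (p : ℕ) : ∏ k ∈ Finset.range p, μ k ≤ M p / M 0 := by
  rw [eq_mul_prod_quotients hpos p, mul_div_cancel_left₀ _ (hpos 0).ne']
  exact Finset.prod_le_prod (fun k _ => hμ k) fun k _ => h k

lemma HasShiftedMoments.of_quotients_div_le {M N : ℕ → ℝ} (h : HasShiftedMoments M)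
    (hM : ∀ p, 0 < M p) (hN : ∀ p, 0 < N p) {a : ℝ} (ha : 0 < a)
    (hle : ∀ p, quotients N (p + 1) / quotients N p ≤
      a * (quotients M (p + 1) / quotients M p)) : HasShiftedMoments N := by
  obtain ⟨C₀, hC₀, H, hH, h⟩ := h
  have hratio : ∀ {L : ℕ → ℝ}, (∀ p, 0 < L p) → ∀ p, 0 < quotients L (p + 1) / quotients L p :=
    fun hL p => div_pos (quotients_pos hL (p + 1)) (quotients_pos hL p)
  refine ⟨|Real.log a| + C₀, by positivity, H, hH, fun p => ?_⟩
  calc Real.log (quotients N (p + 1) / quotients N p)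
      ≤ Real.log (a * (quotients M (p + 1) / quotients M p)) :=
        Real.log_le_log (hratio hN p) (hle p)
    _ = Real.log a + Real.log (quotients M (p + 1) / quotients M p) :=
        Real.log_mul ha.ne' (hratio hM p).ne'
    _ ≤ |Real.log a| * H ^ (p + 1) + C₀ * H ^ (p + 1) :=
        add_le_add ((le_abs_self _).trans
          (le_mul_of_one_le_right (abs_nonneg _) (one_le_pow₀ hH.le))) (h p)
    _ = (|Real.log a| + C₀) * H ^ (p + 1) := by ring

lemma isStrictlyDominated_norm_coeff {M : ℕ → ℝ} (hpos : ∀ p, 0 < M p) {F : PowerSeries ℂ}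
    (hF : F ∈ beurlingSeries M) :
    IsStrictlyDominated (fun p => ‖PowerSeries.coeff p F‖) M := by
  intro t ht
  obtain ⟨C, hC⟩ := hF t ht
  refine ⟨max C 1, by positivity, fun p => (hC p).trans ?_⟩
  have := hpos p
  rw [mul_assoc]
  gcongr
  exact le_max_left C 1

lemma exists_monotone_div_rpow {c : ℕ → ℝ} (hc : ∀ p, 0 < c p) {γ : ℝ}
    (h : AlmostIncreasing fun p => c p / ((p : ℝ) + 1) ^ γ) :
    ∃ a : ℝ, 0 < a ∧ ∃ μ : ℕ → ℝ, (∀ p, 0 < μ p) ∧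
      (Monotone fun p : ℕ => μ p / ((p : ℝ) + 1) ^ γ) ∧ (∀ p, μ p ≤ c p) ∧
      ∀ p, c p ≤ a * μ p := by
  have hbase : ∀ p : ℕ, 0 < ((p : ℝ) + 1) ^ γ := fun p => by positivity
  obtain ⟨a, ha, d, hd, hdc, hcd⟩ := h.exists_monotone_le fun p => (div_pos (hc p) (hbase p)).le
  have hcμ : ∀ p : ℕ, c p ≤ a * (d p * ((p : ℝ) + 1) ^ γ) := fun p => by
    rw [← mul_assoc, ← div_le_iff₀ (hbase p)]
    exact hcd p
  refine ⟨a, ha, fun p => d p * ((p : ℝ) + 1) ^ γ,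
    fun p => pos_of_mul_pos_right ((hc p).trans_le (hcμ p)) ha.le, ?_,
    fun p => (le_div_iff₀ (hbase p)).1 (hdc p), hcμ⟩
  simpa only [mul_div_cancel_right₀ _ (hbase _).ne'] using hd

lemma monotone_log_mul_sub_mul_log {θ μ : ℕ → ℝ} {γ : ℝ} (hθ : ∀ p, 0 < θ p)
    (hμ : ∀ p, 0 < μ p) (hθ_mono : Monotone fun p : ℕ => θ p * ((p : ℝ) + 1) ^ (γ - s))
    (hμ_mono : Monotone fun p : ℕ => μ p / ((p : ℝ) + 1) ^ γ) :
    Monotone fun p : ℕ => Real.log (θ p * μ p) - s * Real.log ((p : ℝ) + 1) := by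
  have hbase : ∀ p : ℕ, 0 < (p : ℝ) + 1 := fun p => by positivity
  have hprod := hθ_mono.mul hμ_mono (fun p => (mul_pos (hθ p) (by positivity)).le)
    fun p => (div_pos (hμ p) (by positivity)).le
  have hprod_pos : ∀ p : ℕ,
      0 < θ p * ((p : ℝ) + 1) ^ (γ - s) * (μ p / ((p : ℝ) + 1) ^ γ) := fun p =>
    mul_pos (mul_pos (hθ p) (by positivity)) (div_pos (hμ p) (by positivity))
  have hlog : ∀ p : ℕ, Real.log (θ p * μ p) - s * Real.log ((p : ℝ) + 1) =
      Real.log (θ p * ((p : ℝ) + 1) ^ (γ - s) * (μ p / ((p : ℝ) + 1) ^ γ)) := fun p => by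
    have hb := hbase p
    rw [← Real.log_rpow hb, ← Real.log_div (mul_pos (hθ p) (hμ p)).ne' (by positivity),
      Real.rpow_sub hb]
    congr 1
    field_simp
  intro p q hpq
  simp only [hlog]
  exact Real.log_le_log (hprod_pos p) (hprod hpq)

lemma weight_log_mul {θ μ : ℕ → ℝ} (hθ : ∀ p, 0 < θ p) (hμ : ∀ p, 0 < μ p) (p : ℕ) :
    weight (fun k => Real.log (θ k * μ k)) p =
      (∏ k ∈ Finset.range p, θ k) * ∏ k ∈ Finset.range p, μ k := by
  simp only [weight, Real.exp_log (mul_pos (hθ _) (hμ _)), Finset.prod_mul_distrib]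

lemma HasShiftedMoments.weight_log_mul {M θ μ : ℕ → ℝ} (h : HasShiftedMoments M)
    (hpos : ∀ p, 0 < M p) (hθ : ∀ p, 0 < θ p) (hθ_anti : Antitone θ) (hμ : ∀ p, 0 < μ p)
    (hμ_le : ∀ p, μ p ≤ quotients M p) {a : ℝ} (ha : 0 < a)
    (hle_μ : ∀ p, quotients M p ≤ a * μ p) :
    HasShiftedMoments (weight fun p => Real.log (θ p * μ p)) := by
  refine h.of_quotients_div_le hpos (weight_pos _) ha fun p => ?_
  rw [quotients_weight, quotients_weight, Real.exp_log (mul_pos (hθ _) (hμ _)),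
    Real.exp_log (mul_pos (hθ _) (hμ _)), mul_div_mul_comm]
  have hm := quotients_pos hpos
  calc θ (p + 1) / θ p * (μ (p + 1) / μ p) ≤ 1 * (μ (p + 1) / μ p) :=
        mul_le_mul_of_nonneg_right (div_le_one_of_le₀ (hθ_anti p.le_succ) (hθ p).le)
          (div_pos (hμ _) (hμ p)).le
    _ = a * (μ (p + 1) / (a * μ p)) := by
        have := (hμ p).ne'
        field_simp
    _ ≤ a * (quotients M (p + 1) / quotients M p) :=
        mul_le_mul_of_nonneg_left
          (div_le_div₀ (hm _).le (hμ_le _) (hm p) (hle_μ p)) ha.le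

lemma exists_smaller_weight {M : ℕ → ℝ} (hpos : ∀ p, 0 < M p) (hsm : HasShiftedMoments M)
    {γ : ℝ} (hsγ : s < γ) (hinc : AlmostIncreasing fun p => quotients M p / ((p : ℝ) + 1) ^ γ)
    {F : PowerSeries ℂ} (hF : F ∈ beurlingSeries M) :
    ∃ l : ℕ → ℝ, (Monotone fun p : ℕ => l p - s * Real.log ((p : ℝ) + 1)) ∧
      HasShiftedMoments (weight l) ∧ F ∈ seriesClass (weight l) 1 ∧
      IsStrictlyDominated (weight l) M := by
  obtain ⟨a, ha, μ, hμ, hμ_mono, hμ_le, hle_μ⟩ := exists_monotone_div_rpow (quotients_pos hpos) hinc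
  have hW : ∀ p, 0 < ∏ k ∈ Finset.range p, μ k := fun p => Finset.prod_pos fun k _ => hμ k
  have hrpow : Monotone fun p : ℕ => ((p : ℝ) + 1) ^ (γ - s) := fun p q hpq =>
    Real.rpow_le_rpow (by positivity) (by gcongr) (sub_pos.2 hsγ).le
  obtain ⟨θ, hθ, hθ_anti, hθ_lim, hθ_mono, C, hC⟩ :=
    ((isStrictlyDominated_norm_coeff hpos hF).of_le_mul_pow_mul (hpos 0) ha
      (le_mul_pow_mul_prod_of_quotients_le hpos hle_μ)).exists_slow_factors
        (fun _ => norm_nonneg _) hW hrpow (fun k => by positivity)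
        ((tendsto_rpow_atTop (sub_pos.2 hsγ)).comp
          (tendsto_atTop_add_const_right _ _ tendsto_natCast_atTop_atTop))
  refine ⟨fun p => Real.log (θ p * μ p), monotone_log_mul_sub_mul_log hθ hμ hθ_mono hμ_mono,
    hsm.weight_log_mul hpos hθ hθ_anti hμ hμ_le ha hle_μ, ⟨C, fun p => ?_⟩, fun t ht => ?_⟩
  · rw [weight_log_mul hθ hμ, one_pow, one_mul, ← mul_assoc]
    exact hC p
  · obtain ⟨D, hD, hθ_le⟩ := exists_prod_range_le_mul_pow hθ hθ_lim ht
    refine ⟨D / M 0, div_pos hD (hpos 0), fun p => ?_⟩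
    calc weight (fun k => Real.log (θ k * μ k)) p ≤ D * t ^ p * (M p / M 0) := by
          rw [weight_log_mul hθ hμ]
          exact mul_le_mul (hθ_le p) (prod_le_div_of_le_quotients hpos (fun k => (hμ k).le) hμ_le p)
            (hW p).le (by positivity)
      _ = D / M 0 * t ^ p * M p := by ring

theorem exists_hasUniformExpansion {M : ℕ → ℝ} (hpos : ∀ p, 0 < M p) (hsm : HasShiftedMoments M)
    (hr : 0 < r) {γ : ℝ} (hrγ : r < γ)
    (hinc : AlmostIncreasing fun p => quotients M p / ((p : ℝ) + 1) ^ γ)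
    {F : PowerSeries ℂ} (hF : F ∈ beurlingSeries M) :
    ∃ f : LogSurface → ℂ, DifferentiableOn ℂ f (sector r) ∧
      ∀ h : ℝ, 0 < h → HasUniformExpansion M h (sector r) f F := by
  obtain ⟨s, hrs, hsγ⟩ := exists_between hrγ
  obtain ⟨l, hl, hl_sm, hl_F, hl_M⟩ := exists_smaller_weight hpos hsm hsγ hinc hF
  obtain ⟨f, hf, A, hA, hfF⟩ := exists_hasUniformExpansion_weight hl hr hrs hl_sm hl_F
  exact ⟨f, hf, fun h hh => hfF.of_isStrictlyDominated hA hl_M hh⟩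

lemma exists_almostIncreasing {M : ℕ → ℝ} (h : ENNReal.ofReal r < gammaIndex M) :
    ∃ γ : ℝ, r < γ ∧ AlmostIncreasing fun p => quotients M p / ((p : ℝ) + 1) ^ γ := by
  obtain ⟨t, ⟨γ, hγ, hinc, rfl⟩, hlt⟩ := lt_sSup_iff.1 h
  exact ⟨γ, (ENNReal.ofReal_lt_ofReal_iff hγ).1 hlt, hinc⟩

lemma borelMap_mk {M : ℕ → ℝ} (hr : 0 < r) {f : LogSurface → ℂ} {F : PowerSeries ℂ}
    (hf : f ∈ beurlingClass M (sector r)) {h : ℝ}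
    (hfF : HasUniformExpansion M h (sector r) f F) :
    (borelMap M r hr ⟨f, hf⟩ : PowerSeries ℂ) = F :=
  ((exists_expansion hr hf).choose_spec 1 one_pos).unique hr hfF

end

end Ultraholomorphic

theorem theorem4p10_general {M : ℕ → ℝ} (hpos : ∀ p, 0 < M p)
    (hsm : Ultraholomorphic.HasShiftedMoments M) {r : ℝ} (hr : 0 < r)
    (h : ENNReal.ofReal r < Ultraholomorphic.gammaIndex M) :
    Function.Surjective (Ultraholomorphic.borelMap M r hr) := by
  rintro ⟨F, hF⟩
  obtain ⟨γ, hγ, hinc⟩ := Ultraholomorphic.exists_almostIncreasing h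
  obtain ⟨f, hf, hfF⟩ := Ultraholomorphic.exists_hasUniformExpansion hpos hsm hr hγ hinc hF
  exact ⟨⟨f, fun t ht => ⟨hf, F, hfF t ht⟩⟩,
    Subtype.ext (Ultraholomorphic.borelMap_mk hr _ (hfF 1 one_pos))⟩

theorem theorem4p10 (M : ℕ → ℝ) (hM : Ultraholomorphic.IsWeightSequence M)
    (hγ : 0 < Ultraholomorphic.gammaIndex M) (hsm : Ultraholomorphic.HasShiftedMoments M) :
    (∀ (r : ℝ) (hr : 0 < r), ENNReal.ofReal r < Ultraholomorphic.gammaIndex M →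
      Function.Surjective (Ultraholomorphic.borelMap M r hr)) ∧
    {r : ℝ | 0 < r ∧ ENNReal.ofReal r < Ultraholomorphic.gammaIndex M} ⊆
      Ultraholomorphic.surjectivityInterval M :=
  ⟨fun _ hr h => theorem4p10_general hM.pos hsm hr h,
    fun _ hr => ⟨hr.1, theorem4p10_general hM.pos hsm hr.1 hr.2⟩⟩
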